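/- Let $X$ be a complex surface (a connected Hausdorff complex manifold of dimension $2$), and let $\pi : X' \to X$ be the blowup of $X$ at a point $p$. A special tensor on a complex surface $S$ is a non-zero holomorphic section $\omega \in H^0(S, S^2\Omega^1_S(-K_S))$. It corresponds to a trace-free endomorphism $\epsilon$ of the tangent bundle $T_S$: if locally $\omega = (\sum_{i,j} a_{ij}\, dz_i \otimes dz_j)/(dz_1 \wedge dz_2)$ with $a_{12}=a_{21}$, then $\epsilon$ has matrix $\begin{pmatrix} -a_{12} & -a_{22} \\ a_{11} & a_{12} \end{pmatrix}$ in the basis $\partial/\partial z_1, \partial/\partial z_2$; put $\det(\omega) := \det(\epsilon)$. 1. Every special tensor $\omega'$ on $X'$ induces a special tensor on $X$: there is exactly one special tensor $\omega$ on $X$ which corresponds to $\omega'$ under the isomorphism $X' \setminus \pi^{-1}(p) \cong X \setminus \{p\}$. 2. Conversely, a special tensor $\omega$ on $X$ lifts to $X'$, that is, there is a special tensor $\omega'$ on $X'$ which corresponds to $\omega$ under the isomorphism $X' \setminus \pi^{-1}(p) \cong X \setminus \{p\}$, if and only if $\omega$ vanishes at $p$ (as a section of $S^2\Omega^1_X(-K_X)$).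 3. If moreover $X$ is compact and $\omega$ is a special tensor on $X$ which vanishes at $p$, then $\det(\omega) = 0$ identically on $X$. -/

import Mathlib

open scoped Manifold ContDiff

noncomputable section

/-- The fibre of `Ω¹ ⊗ Ω¹ ⊗ (Λ²Ω¹)⁻¹` for the tangent space `V`: linear maps from the
alternating two-forms on `V` to the bilinear forms on `V`. The tensor
`(∑ aᵢⱼ dzᵢ ⊗ dzⱼ) / (dz₁ ∧ dz₂)` is the map sending `dz₁ ∧ dz₂` to `∑ aᵢⱼ dzᵢ ⊗ dzⱼ`. -/
abbrev TwistedForm (V : Type*) [AddCommGroup V] [Module ℂ V] : Type _ :=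
  (V [⋀^Fin 2]→ₗ[ℂ] ℂ) →ₗ[ℂ] V →ₗ[ℂ] V →ₗ[ℂ] ℂ

/-- The standard area form `dz₁ ∧ dz₂` on `ℂ × ℂ`. -/
def areaForm : (ℂ × ℂ) [⋀^Fin 2]→ₗ[ℂ] ℂ :=
  (Module.Basis.finTwoProd ℂ).det

theorem areaForm_apply (v w : ℂ × ℂ) : areaForm ![v, w] = v.1 * w.2 - w.1 * v.2 := by
  simp [areaForm, Module.Basis.det_apply, Matrix.det_fin_two, Module.Basis.toMatrix_apply]

/-- The endomorphism of the tangent space given by a twisted form, in terms of the basis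
`∂₁, ∂₂`: it has the matrix `!![-a₁₂, -a₂₂; a₁₁, a₂₁]`. It does not depend on the basis, by
`TwistedForm.apply_eq`. -/
def TwistedForm.endo (t : TwistedForm (ℂ × ℂ)) : (ℂ × ℂ) →ₗ[ℂ] (ℂ × ℂ) :=
  LinearMap.prod (-((t areaForm).flip (0, 1))) ((t areaForm).flip (1, 0))

theorem TwistedForm.endo_apply (t : TwistedForm (ℂ × ℂ)) (v : ℂ × ℂ) :
    t.endo v = (-(t areaForm v (0, 1)), t areaForm v (1, 0)) := rfl

/-- The endomorphism `ε` attached to a twisted form `t` is characterised, without coordinates,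
by `t η (v, w) = η (w, ε v)` for all two-forms `η` and all vectors `v`, `w`. -/
theorem TwistedForm.apply_eq (t : TwistedForm (ℂ × ℂ)) (η : (ℂ × ℂ) [⋀^Fin 2]→ₗ[ℂ] ℂ)
    (v w : ℂ × ℂ) : t η v w = η ![w, t.endo v] := by
  have hη : η = η (Module.Basis.finTwoProd ℂ) • areaForm :=
    AlternatingMap.eq_smul_basis_det _ η
  have hw : w = w.1 • ((1, 0) : ℂ × ℂ) + w.2 • ((0, 1) : ℂ × ℂ) := by ext <;> simp
  have key : t areaForm v w = areaForm ![w, t.endo v] := by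
    rw [areaForm_apply, TwistedForm.endo_apply]
    conv_lhs => rw [hw]
    simp only [map_add, map_smul, smul_eq_mul]
    ring
  rw [hη, map_smul, LinearMap.smul_apply, LinearMap.smul_apply, AlternatingMap.smul_apply, key]

section Surface

variable {X : Type*} [TopologicalSpace X] [ChartedSpace (ℂ × ℂ) X]
variable {X' : Type*} [TopologicalSpace X'] [ChartedSpace (ℂ × ℂ) X']

variable (X) in
/-- Set-theoretic sections of `Ω¹ ⊗ Ω¹ ⊗ K⁻¹` on a complex surface. -/
abbrev TwistedTensor : Type _ :=
  ∀ x : X, TwistedForm (TangentSpace 𝓘(ℂ, ℂ × ℂ) x)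

/-- The pull-back of `τ` under the inverse of the chart `e`, at a point `z` of the target of `e`:
it is the twisted form on `ℂ × ℂ` whose coefficients are those of `τ` in the coordinates `e`. -/
def TwistedTensor.inChart (τ : TwistedTensor X) (e : OpenPartialHomeomorph X (ℂ × ℂ))
    (z : ℂ × ℂ) (η : (ℂ × ℂ) [⋀^Fin 2]→ₗ[ℂ] ℂ) (v w : ℂ × ℂ) : ℂ :=
  τ (e.symm z)
    (η.compLinearMap
      (mfderiv 𝓘(ℂ, ℂ × ℂ) 𝓘(ℂ, ℂ × ℂ) e (e.symm z)).toLinearMap)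
    (mfderiv 𝓘(ℂ, ℂ × ℂ) 𝓘(ℂ, ℂ × ℂ) e.symm z v)
    (mfderiv 𝓘(ℂ, ℂ × ℂ) 𝓘(ℂ, ℂ × ℂ) e.symm z w)

/-- A special tensor on a complex surface: a non-zero holomorphic section of
`S²Ω¹ ⊗ K⁻¹`. -/
structure IsSpecialTensor (τ : TwistedTensor X) : Prop where
  /-- The values are symmetric, that is, they lie in `S²Ω¹ ⊗ K⁻¹`. -/
  symm : ∀ x η v w, τ x η v w = τ x η w v
  /-- In each holomorphic chart the coefficients are holomorphic functions. -/
  holomorphic : ∀ e ∈ IsManifold.maximalAtlas 𝓘(ℂ, ℂ × ℂ) ω X, ∀ η v w,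
    DifferentiableOn ℂ (fun z => τ.inChart e z η v w) e.target
  ne_zero : τ ≠ 0

/-- The determinant of a twisted tensor at `x`: that of the endomorphism of the tangent space
`T_x X` (a copy of `ℂ × ℂ`) which the tensor defines. -/
def TwistedTensor.det (τ : TwistedTensor X) (x : X) : ℂ :=
  LinearMap.det (TwistedForm.endo (τ x))

/-- `π : X' → X` is the blowup of the surface `X` at the point `p`: it is biholomorphic away from
`p`, and, in some coordinates `(x, y)` of `X` centred at `p`, the preimage of the coordinate domain
is the union of the domains of two charts `(x, u)` and `(v, y)` in which `π` is
`(x, u) ↦ (x, x * u)` and `(v, y) ↦ (v * y, y)`, glued along `u ≠ 0`, `v ≠ 0` by `u * v = 1`. -/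
structure IsBlowup (π : X' → X) (p : X) : Prop where
  holomorphic : ContMDiff 𝓘(ℂ, ℂ × ℂ) 𝓘(ℂ, ℂ × ℂ) ω π
  exists_inverse : ∃ σ : X → X',
    ContMDiffOn 𝓘(ℂ, ℂ × ℂ) 𝓘(ℂ, ℂ × ℂ) ω σ {p}ᶜ ∧
    (∀ x, x ≠ p → π (σ x) = x) ∧ (∀ x', π x' ≠ p → σ (π x') = x')
  exists_charts : ∃ φ ∈ IsManifold.maximalAtlas 𝓘(ℂ, ℂ × ℂ) ω X,
    ∃ ψ₀ ∈ IsManifold.maximalAtlas 𝓘(ℂ, ℂ × ℂ) ω X',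
    ∃ ψ₁ ∈ IsManifold.maximalAtlas 𝓘(ℂ, ℂ × ℂ) ω X',
      p ∈ φ.source ∧ φ p = 0 ∧
      ψ₀.source ∪ ψ₁.source = π ⁻¹' φ.source ∧
      ψ₀.target = {q | (q.1, q.1 * q.2) ∈ φ.target} ∧
      ψ₁.target = {q | (q.1 * q.2, q.2) ∈ φ.target} ∧
      (∀ x ∈ ψ₀.source, φ (π x) = ((ψ₀ x).1, (ψ₀ x).1 * (ψ₀ x).2)) ∧
      (∀ x ∈ ψ₁.source, φ (π x) = ((ψ₁ x).1 * (ψ₁ x).2, (ψ₁ x).2)) ∧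
      ψ₀ '' (ψ₀.source ∩ ψ₁.source) = {q ∈ ψ₀.target | q.2 ≠ 0} ∧
      ψ₁ '' (ψ₀.source ∩ ψ₁.source) = {q ∈ ψ₁.target | q.1 ≠ 0} ∧
      (∀ x ∈ ψ₀.source ∩ ψ₁.source, (ψ₀ x).2 * (ψ₁ x).1 = 1)

/-- The tensors `τ'` on `X'` and `τ` on `X` correspond to each other under the biholomorphic map
`X' \ π⁻¹(p) → X \ {p}` induced by `π`, that is, `τ' = π^* τ` there: for each two-form `η` at
`π x`, the form `τ' (π^* η)` is the pull-back of the form `τ η`. -/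
def CorrespondOff (π : X' → X) (p : X) (τ' : TwistedTensor X') (τ : TwistedTensor X) : Prop :=
  ∀ x : X', π x ≠ p →
    ∀ (η : TangentSpace 𝓘(ℂ, ℂ × ℂ) (π x) [⋀^Fin 2]→ₗ[ℂ] ℂ)
      (v w : TangentSpace 𝓘(ℂ, ℂ × ℂ) x),
      τ' x (η.compLinearMap (mfderiv 𝓘(ℂ, ℂ × ℂ) 𝓘(ℂ, ℂ × ℂ) π x).toLinearMap) v w =
        τ (π x) η (mfderiv 𝓘(ℂ, ℂ × ℂ) 𝓘(ℂ, ℂ × ℂ) π x v)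
          (mfderiv 𝓘(ℂ, ℂ × ℂ) 𝓘(ℂ, ℂ × ℂ) π x w)

end Surface

end

/-! Since two-forms on `ℂ × ℂ` are multiples of `areaForm`, a twisted tensor is the same as a
bilinear form `B` at each point, and pulling back along a linear map `L` becomes `(det L)⁻¹ • L^*B`
(`PlaneForm.pull`). The three assertions are then statements about such families, holomorphic when
read in charts (`HolAt`).

Descent: away from `p`, pull the tensor back along the inverse of `π`. An isolated singularity in
dimension two is removable by Hartogs (`exists_differentiableAt_eq_of_ne`), so the section extends
over `p` (`exists_holAt_extension`). Uniqueness, symmetry and non-vanishing follow by continuity,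
because `p` is not isolated and the complement of the exceptional curve is dense.

Lifting: in the chart `(x, u) ↦ (x, x * u)` the Jacobian determinant is `x`, so the pull-back is
`x⁻¹ • N` with `N` holomorphic (`pullNumerator`). If the tensor vanishes at `p`, then `N` vanishes
on `x = 0`, which is mapped to `p`, and the quotient is holomorphic; the other chart is treated
alike (`IsBlowup.exists_lift`). Conversely, a holomorphic lift forces `N = 0` on `x = 0`. The `dx ⊗
dx` coefficient of `N` at `(0, u)` is `B (1, u) (1, u)`, with `B` the tensor at `p` in coordinates;
a symmetric form for which this is zero for all `u` is zero (`IsBlowup.eq_zero_of_lift`).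

Determinant: the factor `(det L) ^ 2` from the quadratic form cancels that from the two-form
(`PlaneForm.disc_pull`), so the determinant is a holomorphic function. On a compact connected
surface it is constant, hence equal to its value at `p`, which is zero. -/

/-! ### Holomorphic extension in two variables by Cauchy integrals -/

-- This is the one-variable Cauchy estimate on each complex line through `q₀` in a unit direction.
open Metric Set Filter Topology in
theorem norm_fderiv_le_of_forall_mem_closedBall {V E : Type*} [NormedAddCommGroup V]
    [NormedSpace ℂ V] [NormedAddCommGroup E] [NormedSpace ℂ E]
    {g : V → E} {q₀ : V} {δ M : ℝ} (hδ : 0 < δ)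
    (hg : ∀ q ∈ closedBall q₀ δ, DifferentiableAt ℂ g q)
    (hM : ∀ q ∈ closedBall q₀ δ, ‖g q‖ ≤ M) : ‖fderiv ℂ g q₀‖ ≤ M / δ := by
  have hM0 : 0 ≤ M := (norm_nonneg _).trans (hM q₀ (mem_closedBall_self hδ.le))
  refine ContinuousLinearMap.opNorm_le_of_unit_norm (by positivity) fun v hv => ?_
  have hmem : ∀ s ∈ closedBall (0 : ℂ) δ, q₀ + s • v ∈ closedBall q₀ δ := by
    intro s hs
    simpa [mem_closedBall, dist_eq_norm, norm_smul, hv] using hs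
  have hd : ∀ s ∈ closedBall (0 : ℂ) δ,
      HasDerivAt (fun s : ℂ => g (q₀ + s • v)) (fderiv ℂ g (q₀ + s • v) v) s := by
    intro s hs
    have h1 : HasDerivAt (fun s : ℂ => q₀ + s • v) v s := by
      simpa using ((hasDerivAt_id s).smul_const v).const_add q₀
    exact (hg _ (hmem s hs)).hasFDerivAt.comp_hasDerivAt s h1
  have h0 := hd 0 (mem_closedBall_self hδ.le)
  simp only [zero_smul, add_zero] at h0
  rw [← h0.deriv]
  refine Complex.norm_deriv_le_of_forall_mem_sphere_norm_le hδ ?_ ?_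
  · refine DifferentiableOn.diffContOnCl fun s hs => ?_
    rw [closure_ball _ hδ.ne'] at hs
    exact (hd s hs).differentiableAt.differentiableWithinAt
  · exact fun s hs => hM _ (hmem s (sphere_subset_closedBall hs))

open Metric Set Filter Topology MeasureTheory in
/-- An integral over a compact interval depends holomorphically on a parameter if the integrand
does. -/
theorem differentiableAt_intervalIntegral_of_continuousOn {V E : Type*} [NormedAddCommGroup V]
    [NormedSpace ℂ V] [ProperSpace V] [NormedAddCommGroup E] [NormedSpace ℂ E]
    {k : V → ℝ → E} {q₀ : V} {R a b : ℝ} (hR : 0 < R)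
    (hd : ∀ t, ∀ q ∈ closedBall q₀ R, DifferentiableAt ℂ (fun q => k q t) q)
    (hc : ContinuousOn (fun p : V × ℝ => k p.1 p.2) (closedBall q₀ R ×ˢ univ)) :
    DifferentiableAt ℂ (fun q => ∫ t in a..b, k q t) q₀ := by
  have hK : IsCompact (closedBall q₀ R ×ˢ uIcc a b) :=
    (isCompact_closedBall q₀ R).prod isCompact_uIcc
  have hcK := hc.mono (prod_mono_right (s := closedBall q₀ R) (subset_univ (uIcc a b)))
  obtain ⟨M, hM⟩ := hK.exists_bound_of_continuousOn hcK
  have hct : ∀ q ∈ closedBall q₀ R, Continuous (k q) := by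
    intro q hq
    rw [← continuousOn_univ]
    exact hc.comp (Continuous.continuousOn (by fun_prop : Continuous fun t : ℝ => (q, t)))
      fun t _ => ⟨hq, mem_univ t⟩
  -- Half the radius: balls of radius `R / 2` about points of `ball q₀ (R / 2)` stay in the large
  -- ball, so the Cauchy estimate bounds the derivative uniformly there.
  have hR2 : 0 < R / 2 := by positivity
  have hsub : ∀ q ∈ ball q₀ (R / 2), closedBall q (R / 2) ⊆ closedBall q₀ R := fun q hq =>
    closedBall_subset_closedBall' (by linarith [mem_ball.1 hq])
  have hsubR : ball q₀ (R / 2) ⊆ closedBall q₀ R :=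
    ball_subset_closedBall.trans (closedBall_subset_closedBall (by linarith))
  -- The derivative at `q₀` is continuous in `t`: apply the Cauchy estimate to the difference of two
  -- slices, which is uniformly small by compactness.
  have hcont : ContinuousOn (fun t => fderiv ℂ (fun q => k q t) q₀) (uIcc a b) := by
    have hu := hK.uniformContinuousOn_of_continuous hcK
    rw [Metric.uniformContinuousOn_iff] at hu
    rw [Metric.continuousOn_iff]
    intro t ht ε hε
    obtain ⟨η, hη, H⟩ := hu (ε / 2 * R) (by positivity)
    refine ⟨η, hη, fun s hs hst => ?_⟩
    have hq₀ : q₀ ∈ closedBall q₀ R := mem_closedBall_self hR.le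
    have hle : ‖fderiv ℂ (fun q => k q s - k q t) q₀‖ ≤ (ε / 2 * R) / R := by
      refine norm_fderiv_le_of_forall_mem_closedBall hR
        (fun q hq => (hd s q hq).sub (hd t q hq)) fun q hq => ?_
      rw [← dist_eq_norm]
      refine (H (q, s) ⟨hq, hs⟩ (q, t) ⟨hq, ht⟩ ?_).le
      simpa [Prod.dist_eq] using hst
    rw [fderiv_fun_sub (hd s _ hq₀) (hd t _ hq₀), ← dist_eq_norm,
      mul_div_assoc, div_self hR.ne'] at hle
    linarith
  refine (intervalIntegral.hasFDerivAt_integral_of_dominated_of_fderiv_le (𝕜 := ℂ)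
    (F' := fun q t => fderiv ℂ (fun q => k q t) q) (bound := fun _ => M / (R / 2))
    (ball_mem_nhds q₀ hR2) ?_ ?_ ?_ ?_ ?_ ?_).differentiableAt
  · filter_upwards [ball_mem_nhds q₀ hR2] with q hq
    exact (hct q (hsubR hq)).aestronglyMeasurable
  · exact (hct q₀ (mem_closedBall_self hR.le)).intervalIntegrable _ _
  · exact (hcont.mono uIoc_subset_uIcc).aestronglyMeasurable measurableSet_uIoc
  · refine Eventually.of_forall fun t ht q hq => ?_
    exact norm_fderiv_le_of_forall_mem_closedBall hR2 (fun q' hq' => hd t q' (hsub q hq hq'))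
      fun q' hq' => hM (q', t) ⟨hsub q hq hq', uIoc_subset_uIcc ht⟩
  · exact intervalIntegrable_const
  · exact Eventually.of_forall fun t _ q hq => (hd t q (hsubR hq)).hasFDerivAt

-- The kernel has no pole since `ζ` runs over the circle while `q.1` stays inside it, so one can
-- differentiate under the integral sign.
open Metric Set Filter Topology in
theorem differentiableAt_cauchyIntegral {E : Type*} [NormedAddCommGroup E] [NormedSpace ℂ E]
    {f : ℂ × ℂ → E} {a b : ℂ} {r : ℝ}
    (hf : ∀ ζ ∈ sphere a r, ∀ w ∈ ball b r, DifferentiableAt ℂ f (ζ, w))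
    {q : ℂ × ℂ} (hq : q ∈ ball a r ×ˢ ball b r) :
    DifferentiableAt ℂ (fun q : ℂ × ℂ => ∮ ζ in C(a, r), (ζ - q.1)⁻¹ • f (ζ, q.2)) q := by
  have hr : 0 < r := dist_nonneg.trans_lt (mem_ball.1 hq.1)
  obtain ⟨R, hR, hsub⟩ := nhds_basis_closedBall.mem_iff.1
    ((isOpen_ball.prod isOpen_ball).mem_nhds hq)
  have hne : ∀ q' ∈ closedBall q R, ∀ t, circleMap a r t - q'.1 ≠ 0 := by
    intro q' hq' t h
    have h1 := (hsub hq').1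
    rw [← sub_eq_zero.1 h] at h1
    exact circleMap_notMem_ball a r t h1
  have hsph : ∀ t, circleMap a r t ∈ sphere a r := circleMap_mem_sphere a hr.le
  refine differentiableAt_intervalIntegral_of_continuousOn hR (fun t q' hq' => ?_) ?_
  · refine DifferentiableAt.const_smul (DifferentiableAt.smul ?_ ?_) _
    · exact ((differentiableAt_const _).sub differentiableAt_fst).inv (hne q' hq' t)
    · exact (hf _ (hsph t) _ (hsub hq').2).comp q'
        ((differentiableAt_const _).prodMk differentiableAt_snd)
  · refine ContinuousOn.smul (Continuous.continuousOn ?_) (ContinuousOn.smul ?_ ?_)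
    · simp only [deriv_circleMap]
      fun_prop
    · refine ContinuousOn.inv₀ (Continuous.continuousOn ?_) fun p hp => hne p.1 hp.1 p.2
      fun_prop
    · intro p hp
      refine ContinuousAt.continuousWithinAt ?_
      refine ContinuousAt.comp (g := f) (f := fun p : (ℂ × ℂ) × ℝ => (circleMap a r p.2, p.1.2))
        (hf _ (hsph p.2) _ (hsub hp.1).2).continuousAt ?_
      fun_prop

open Metric Set Filter Topology in
/-- If `f` is holomorphic near `{|z - a| = r} × {|w - b| < r}`, then there is a holomorphic function
on the bidisc whose slices are the holomorphic extensions of those slices of `f` that have one. -/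
theorem exists_differentiableAt_forall_slice_eq {E : Type*} [NormedAddCommGroup E]
    [NormedSpace ℂ E] [CompleteSpace E] {f : ℂ × ℂ → E} {a b : ℂ} {r : ℝ}
    (hf : ∀ ζ ∈ sphere a r, ∀ w ∈ ball b r, DifferentiableAt ℂ f (ζ, w)) :
    ∃ G : ℂ × ℂ → E, (∀ q ∈ ball a r ×ˢ ball b r, DifferentiableAt ℂ G q) ∧
      ∀ w (h : ℂ → E), (∀ z ∈ closedBall a r, DifferentiableAt ℂ h z) →
        (∀ ζ ∈ sphere a r, h ζ = f (ζ, w)) → ∀ z ∈ ball a r, G (z, w) = h z := by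
  -- The Cauchy integral in the first variable makes sense for every `w`, whether or not the slice
  -- of `f` extends; when it does, Cauchy's formula identifies the two.
  refine ⟨fun q => (2 * Real.pi * Complex.I : ℂ)⁻¹ •
    ∮ ζ in C(a, r), (ζ - q.1)⁻¹ • f (ζ, q.2),
    fun q hq => (differentiableAt_cauchyIntegral hf hq).const_smul _, fun w h hh heq z hz => ?_⟩
  have hr : 0 < r := dist_nonneg.trans_lt (mem_ball.1 hz)
  have hh' : DiffContOnCl ℂ h (ball a r) := by
    refine DifferentiableOn.diffContOnCl fun s hs => ?_
    rw [closure_ball _ hr.ne'] at hs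
    exact (hh s hs).differentiableWithinAt
  beta_reduce
  rw [← hh'.two_pi_i_inv_smul_circleIntegral_sub_inv_smul hz]
  congr 1
  exact circleIntegral.integral_congr hr.le fun ζ hζ =>
    congrArg ((ζ - z)⁻¹ • ·) (heq ζ hζ).symm

open Metric Set Filter Topology in
/-- Hartogs: an isolated singularity of a holomorphic function of two variables is removable. -/
theorem exists_differentiableAt_eq_of_ne {E : Type*} [NormedAddCommGroup E]
    [NormedSpace ℂ E] [CompleteSpace E] {f : ℂ × ℂ → E} {c : ℂ × ℂ}
    (hf : ∀ᶠ q in 𝓝 c, q ≠ c → DifferentiableAt ℂ f q) :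
    ∃ G : ℂ × ℂ → E, ∀ᶠ q in 𝓝 c, DifferentiableAt ℂ G q ∧ (q ≠ c → f q = G q) := by
  obtain ⟨a, b⟩ := c
  obtain ⟨r, hr, hsub⟩ := nhds_basis_closedBall.mem_iff.1 hf
  have hsub' : ∀ z ∈ closedBall a r, ∀ w ∈ closedBall b r, (z, w) ≠ (a, b) →
      DifferentiableAt ℂ f (z, w) := by
    intro z hz w hw
    refine hsub (?_ : (z, w) ∈ closedBall (a, b) r)
    rw [← closedBall_prod_same]
    exact ⟨hz, hw⟩
  obtain ⟨G, hG, hGf⟩ := exists_differentiableAt_forall_slice_eq (f := f) (a := a) (b := b) (r := r)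
    fun ζ hζ w hw => hsub' ζ (sphere_subset_closedBall hζ) w (ball_subset_closedBall hw) (by
      rintro h
      rw [(Prod.mk.inj h).1] at hζ
      simp [hr.ne] at hζ)
  have hmem : ball a r ×ˢ ball b r ∈ 𝓝 (a, b) :=
    (isOpen_ball.prod isOpen_ball).mem_nhds ⟨mem_ball_self hr, mem_ball_self hr⟩
  -- A slice with `w ≠ b` misses the singular point, so it is its own extension. The remaining slice
  -- `w = b` is reached by letting `w'` tend to `b`.
  have hoff : ∀ z ∈ ball a r, ∀ w ∈ ball b r, w ≠ b → f (z, w) = G (z, w) := by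
    intro z hz w hw hwb
    refine (hGf w (fun z => f (z, w)) (fun z' hz' => ?_) (fun _ _ => rfl) z hz).symm
    exact (hsub' z' hz' w (ball_subset_closedBall hw) (by simp [hwb])).comp z'
      (differentiableAt_id.prodMk (differentiableAt_const _))
  refine ⟨G, ?_⟩
  filter_upwards [hmem] with q hq
  refine ⟨hG q hq, fun hne => ?_⟩
  obtain ⟨z, w⟩ := q
  have hfq := hsub' z (ball_subset_closedBall hq.1) w (ball_subset_closedBall hq.2) hne
  have hz : Tendsto (fun w' => (z, w')) (𝓝[≠] w) (𝓝 (z, w)) :=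
    ((by fun_prop : Continuous fun w' : ℂ => (z, w')).tendsto w).mono_left nhdsWithin_le_nhds
  refine tendsto_nhds_unique_of_frequently_eq (hfq.continuousAt.tendsto.comp hz)
    ((hG _ hq).continuousAt.tendsto.comp hz) (Eventually.frequently ?_)
  have h2 : ∀ᶠ w' in 𝓝[≠] w, w' ≠ b := by
    by_cases hwb : w = b
    · rw [← hwb]; exact self_mem_nhdsWithin
    · exact nhdsWithin_le_nhds (isOpen_ne.mem_nhds hwb)
  filter_upwards [h2, nhdsWithin_le_nhds (isOpen_ball.mem_nhds hq.2)] with w' h2 h3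
  exact hoff z hq.1 w' h3 h2

open Metric Set Filter Topology in
/-- A holomorphic function of two variables that vanishes where the first coordinate does is
divisible by it. -/
theorem exists_differentiableAt_eq_inv_fst_smul {E : Type*} [NormedAddCommGroup E]
    [NormedSpace ℂ E] [CompleteSpace E] {N : ℂ × ℂ → E} {b : ℂ}
    (hN : ∀ᶠ q in 𝓝 ((0 : ℂ), b), DifferentiableAt ℂ N q ∧ (q.1 = 0 → N q = 0)) :
    ∃ G : ℂ × ℂ → E, ∀ᶠ q in 𝓝 ((0 : ℂ), b),
      DifferentiableAt ℂ G q ∧ (q.1 ≠ 0 → q.1⁻¹ • N q = G q) := by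
  obtain ⟨r, hr, hsub⟩ := nhds_basis_closedBall.mem_iff.1 hN
  have hsub' : ∀ z ∈ closedBall (0 : ℂ) r, ∀ w ∈ closedBall b r,
      DifferentiableAt ℂ N (z, w) ∧ (z = 0 → N (z, w) = 0) := by
    intro z hz w hw
    refine hsub (?_ : (z, w) ∈ closedBall (0, b) r)
    rw [← closedBall_prod_same]
    exact ⟨hz, hw⟩
  obtain ⟨G, hG, hGf⟩ := exists_differentiableAt_forall_slice_eq (f := fun q => q.1⁻¹ • N q)
    (a := 0) (b := b) (r := r) fun ζ hζ w hw => by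
      refine DifferentiableAt.smul (differentiableAt_fst.inv ?_)
        (hsub' ζ (sphere_subset_closedBall hζ) w (ball_subset_closedBall hw)).1
      rintro rfl
      simp [hr.ne] at hζ
  have hmem : ball 0 r ×ˢ ball b r ∈ 𝓝 ((0 : ℂ), b) :=
    (isOpen_ball.prod isOpen_ball).mem_nhds ⟨mem_ball_self hr, mem_ball_self hr⟩
  refine ⟨G, ?_⟩
  filter_upwards [hmem] with q hq
  refine ⟨hG q hq, fun hne => ?_⟩
  obtain ⟨z, w⟩ := q
  have hw := ball_subset_closedBall hq.2
  have h0 : N (0, w) = 0 := (hsub' 0 (mem_closedBall_self hr.le) w hw).2 rfl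
  -- On each slice the holomorphic extension of `z⁻¹ • N` across `0` is the divided difference
  -- `dslope`.
  have hds : ∀ z : ℂ, z ≠ 0 → dslope (fun z => N (z, w)) 0 z = z⁻¹ • N (z, w) := by
    intro z hz
    simp [dslope_of_ne _ hz, slope_def_module, h0]
  refine ((hGf w (dslope (fun z => N (z, w)) 0) ?_ ?_ z hq.1).trans (hds z hne)).symm
  · intro z' hz'
    have hd : DifferentiableOn ℂ (fun z => N (z, w)) (closedBall 0 r) := fun z hz =>
      ((hsub' z hz w hw).1.comp z
        (differentiableAt_id.prodMk (differentiableAt_const _))).differentiableWithinAt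
    by_cases hz0 : z' = 0
    · rw [hz0]
      exact ((Complex.differentiableOn_dslope (closedBall_mem_nhds _ hr)).2 hd).differentiableAt
        (closedBall_mem_nhds _ hr)
    · exact (differentiableAt_dslope_of_ne hz0).2 ((hsub' z' hz' w hw).1.comp z'
        (differentiableAt_id.prodMk (differentiableAt_const _)))
  · intro ζ hζ
    refine hds ζ ?_
    rintro rfl
    simp [hr.ne] at hζ

open Filter Topology in
theorem exists_differentiableAt_eq_inv_snd_smul {E : Type*} [NormedAddCommGroup E]
    [NormedSpace ℂ E] [CompleteSpace E] {N : ℂ × ℂ → E} {b : ℂ}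
    (hN : ∀ᶠ q in 𝓝 (b, (0 : ℂ)), DifferentiableAt ℂ N q ∧ (q.2 = 0 → N q = 0)) :
    ∃ G : ℂ × ℂ → E, ∀ᶠ q in 𝓝 (b, (0 : ℂ)),
      DifferentiableAt ℂ G q ∧ (q.2 ≠ 0 → q.2⁻¹ • N q = G q) := by
  have hswap : ∀ x y : ℂ, Tendsto Prod.swap (𝓝 (x, y)) (𝓝 (y, x)) := fun x y =>
    continuous_swap.tendsto (x, y)
  have hd : ∀ q : ℂ × ℂ, DifferentiableAt ℂ (Prod.swap : ℂ × ℂ → ℂ × ℂ) q := fun q =>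
    differentiableAt_snd.prodMk differentiableAt_fst
  obtain ⟨G, hG⟩ := exists_differentiableAt_eq_inv_fst_smul (N := N ∘ Prod.swap) (b := b) (by
    filter_upwards [(hswap 0 b).eventually hN] with q hq
    exact ⟨hq.1.comp q (hd q), hq.2⟩)
  refine ⟨G ∘ Prod.swap, ?_⟩
  filter_upwards [(hswap b 0).eventually hG] with q hq
  exact ⟨hq.1.comp q (hd q), hq.2⟩

/-! ### Linear algebra of twisted forms on the plane -/

noncomputable section

set_option maxSynthPendingDepth 3

/-- Bilinear forms on `ℂ × ℂ`. -/
abbrev PlaneForm : Type := (ℂ × ℂ) →L[ℂ] (ℂ × ℂ) →L[ℂ] ℂ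

/-- The determinant of an endomorphism of `ℂ × ℂ`. -/
def planeDet (L : (ℂ × ℂ) →L[ℂ] (ℂ × ℂ)) : ℂ :=
  (L (1, 0)).1 * (L (0, 1)).2 - (L (0, 1)).1 * (L (1, 0)).2

theorem clm_plane_apply {E : Type*} [AddCommGroup E] [Module ℂ E] [TopologicalSpace E]
    (L : (ℂ × ℂ) →L[ℂ] E) (v : ℂ × ℂ) : L v = v.1 • L (1, 0) + v.2 • L (0, 1) := by
  rw [← map_smul, ← map_smul, ← map_add]
  simp

theorem planeDet_id : planeDet (ContinuousLinearMap.id ℂ (ℂ × ℂ)) = 1 := by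
  simp [planeDet]

theorem planeDet_comp (L M : (ℂ × ℂ) →L[ℂ] (ℂ × ℂ)) :
    planeDet (L.comp M) = planeDet L * planeDet M := by
  simp only [planeDet, ContinuousLinearMap.comp_apply]
  rw [clm_plane_apply L (M (1, 0)), clm_plane_apply L (M (0, 1))]
  simp only [Prod.fst_add, Prod.snd_add, Prod.smul_fst, Prod.smul_snd, smul_eq_mul]
  ring

theorem DifferentiableAt.planeDet {V : Type*} [NormedAddCommGroup V] [NormedSpace ℂ V]
    {L : V → (ℂ × ℂ) →L[ℂ] (ℂ × ℂ)} {z : V} (hL : DifferentiableAt ℂ L z) :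
    DifferentiableAt ℂ (fun z => _root_.planeDet (L z)) z := by
  have h (u : ℂ × ℂ) : DifferentiableAt ℂ (fun z => L z u) z :=
    hL.clm_apply (differentiableAt_const u)
  exact ((h _).fst.mul (h _).snd).sub ((h _).fst.mul (h _).snd)

theorem eq_smul_areaForm (η : (ℂ × ℂ) [⋀^Fin 2]→ₗ[ℂ] ℂ) :
    η = η ![(1, 0), (0, 1)] • areaForm := by
  have h := AlternatingMap.eq_smul_basis_det (Module.Basis.finTwoProd ℂ) η
  have h2 : (⇑(Module.Basis.finTwoProd ℂ) : Fin 2 → ℂ × ℂ) = ![(1, 0), (0, 1)] := by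
    ext i <;> fin_cases i <;> simp
  rw [h2] at h
  exact h

theorem alternatingMap_apply_clm (η : (ℂ × ℂ) [⋀^Fin 2]→ₗ[ℂ] ℂ) (L : (ℂ × ℂ) →L[ℂ] (ℂ × ℂ)) :
    η ![L (1, 0), L (0, 1)] = η ![(1, 0), (0, 1)] * planeDet L := by
  conv_lhs => rw [eq_smul_areaForm η]
  rw [AlternatingMap.smul_apply, areaForm_apply, smul_eq_mul]
  rfl

/-- The pull-back of the tensor `B / (dz₁ ∧ dz₂)` under the linear map `L`, divided by
`1 / (dz₁ ∧ dz₂)`. It is zero if `L` is not invertible. -/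
def PlaneForm.pull (L : (ℂ × ℂ) →L[ℂ] (ℂ × ℂ)) (B : PlaneForm) : PlaneForm :=
  (planeDet L)⁻¹ • B.bilinearComp L L

namespace PlaneForm

theorem apply_eq (B : PlaneForm) (v w : ℂ × ℂ) :
    B v w = v.1 * (w.1 * B (1, 0) (1, 0) + w.2 * B (1, 0) (0, 1)) +
      v.2 * (w.1 * B (0, 1) (1, 0) + w.2 * B (0, 1) (0, 1)) := by
  rw [clm_plane_apply B v]
  simp only [add_apply, smul_apply, smul_eq_mul]
  rw [clm_plane_apply (B (1, 0)) w, clm_plane_apply (B (0, 1)) w]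
  simp only [smul_eq_mul]

theorem pull_apply (L : (ℂ × ℂ) →L[ℂ] (ℂ × ℂ)) (B : PlaneForm) (v w : ℂ × ℂ) :
    pull L B v w = (planeDet L)⁻¹ * B (L v) (L w) := rfl

theorem pull_comp (L M : (ℂ × ℂ) →L[ℂ] (ℂ × ℂ)) (B : PlaneForm) :
    pull (L.comp M) B = pull M (pull L B) := by
  refine ContinuousLinearMap.ext fun v => ContinuousLinearMap.ext fun w => ?_
  simp only [pull_apply, planeDet_comp, ContinuousLinearMap.comp_apply]
  ring

theorem pull_id (B : PlaneForm) : pull (ContinuousLinearMap.id ℂ (ℂ × ℂ)) B = B := by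
  refine ContinuousLinearMap.ext fun v => ContinuousLinearMap.ext fun w => ?_
  simp [pull_apply, planeDet_id]

theorem pull_flip (L : (ℂ × ℂ) →L[ℂ] (ℂ × ℂ)) (B : PlaneForm) :
    pull L B.flip = (pull L B).flip := rfl

theorem pull_zero (L : (ℂ × ℂ) →L[ℂ] (ℂ × ℂ)) : pull L 0 = 0 := by
  refine ContinuousLinearMap.ext fun v => ContinuousLinearMap.ext fun w => ?_
  simp [pull_apply]

theorem _root_.DifferentiableAt.bilinearComp {V : Type*} [NormedAddCommGroup V] [NormedSpace ℂ V]
    {L : V → (ℂ × ℂ) →L[ℂ] (ℂ × ℂ)} {B : V → PlaneForm} {z : V} (hL : DifferentiableAt ℂ L z)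
    (hB : DifferentiableAt ℂ B z) :
    DifferentiableAt ℂ (fun z => (B z).bilinearComp (L z) (L z)) z := by
  have hF (B : PlaneForm) : DifferentiableAt ℂ (fun B : PlaneForm => B.flip) B :=
    (ContinuousLinearMap.flipₗᵢ ℂ (ℂ × ℂ) (ℂ × ℂ) ℂ).differentiableAt
  have h2 : DifferentiableAt ℂ (fun z => ((B z).comp (L z)).flip) z :=
    (hF _).comp z (hB.clm_comp hL)
  exact (hF _).comp z (h2.clm_comp hL)

theorem _root_.DifferentiableAt.planeForm_pull {V : Type*} [NormedAddCommGroup V]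
    [NormedSpace ℂ V] {L : V → (ℂ × ℂ) →L[ℂ] (ℂ × ℂ)} {B : V → PlaneForm} {z : V}
    (hL : DifferentiableAt ℂ L z) (hB : DifferentiableAt ℂ B z) (h0 : planeDet (L z) ≠ 0) :
    DifferentiableAt ℂ (fun z => pull (L z) (B z)) z :=
  DifferentiableAt.fun_smul (hL.planeDet.fun_inv h0) (hL.bilinearComp hB)

/-- The determinant of a bilinear form on `ℂ × ℂ`. -/
def disc (B : PlaneForm) : ℂ :=
  B (1, 0) (1, 0) * B (0, 1) (0, 1) - B (1, 0) (0, 1) * B (0, 1) (1, 0)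

/-- The Gram determinant is multiplied by `planeDet L ^ 2`, and rescaling a form in two variables by
`(planeDet L)⁻¹` multiplies it by the inverse square. This is why the determinant of a special
tensor is a function. -/
theorem disc_pull (L : (ℂ × ℂ) →L[ℂ] (ℂ × ℂ)) (B : PlaneForm) (h0 : planeDet L ≠ 0) :
    disc (pull L B) = disc B := by
  have key : B (L (1, 0)) (L (1, 0)) * B (L (0, 1)) (L (0, 1)) -
      B (L (1, 0)) (L (0, 1)) * B (L (0, 1)) (L (1, 0)) = planeDet L ^ 2 * disc B := by
    simp only [apply_eq B (L _) (L _), planeDet, disc]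
    ring
  have : disc (pull L B) = (planeDet L)⁻¹ ^ 2 * (B (L (1, 0)) (L (1, 0)) *
      B (L (0, 1)) (L (0, 1)) - B (L (1, 0)) (L (0, 1)) * B (L (0, 1)) (L (1, 0))) := by
    simp only [disc, pull_apply]
    ring
  rw [this, key]
  field_simp

/-- The hypothesis is a quadratic polynomial in `u` that vanishes identically; the values at `0`,
`1` and `-1` isolate its coefficients. Symmetry excludes the alternating forms. -/
theorem eq_zero_of_symm {B : PlaneForm} (hs : ∀ v w, B v w = B w v)
    (h : ∀ u : ℂ, B (1, u) (1, u) = 0) : B = 0 := by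
  have hB : ∀ u : ℂ, B (1, 0) (1, 0) + 2 * u * B (1, 0) (0, 1) + u ^ 2 * B (0, 1) (0, 1) = 0 := by
    intro u
    have hu := h u
    rw [apply_eq, hs (0, 1) (1, 0)] at hu
    linear_combination hu
  have h0 : B (1, 0) (1, 0) = 0 := by simpa using hB 0
  have h1 : B (1, 0) (0, 1) = 0 := by linear_combination (hB 1 - hB (-1)) / 4
  have h2 : B (0, 1) (0, 1) = 0 := by linear_combination (hB 1 + hB (-1)) / 2 - h0
  refine ContinuousLinearMap.ext fun v => ContinuousLinearMap.ext fun w => ?_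
  rw [apply_eq, hs (0, 1) (1, 0), h0, h1, h2]
  simp

/-- The twisted form `B / (dz₁ ∧ dz₂)`. -/
def toTwistedForm (B : PlaneForm) : TwistedForm (ℂ × ℂ) :=
  LinearMap.mk₂ ℂ (fun η v => η ![(1, 0), (0, 1)] • (B v : (ℂ × ℂ) →ₗ[ℂ] ℂ))
    (fun η η' v => by simp [add_smul]) (fun c η v => by simp [mul_smul])
    (fun η v v' => by simp) (fun c η v => by simp [smul_comm c])

theorem toTwistedForm_apply (B : PlaneForm) (η : (ℂ × ℂ) [⋀^Fin 2]→ₗ[ℂ] ℂ) (v w : ℂ × ℂ) :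
    B.toTwistedForm η v w = η ![(1, 0), (0, 1)] * B v w := rfl

end PlaneForm

namespace TwistedForm

/-- The bilinear form `B` for which a twisted form is `B / (dz₁ ∧ dz₂)`. -/
def toPlaneForm (t : TwistedForm (ℂ × ℂ)) : PlaneForm :=
  LinearMap.toContinuousLinearMap
    ((LinearMap.toContinuousLinearMap (E := ℂ × ℂ) (F' := ℂ) (𝕜 := ℂ)).toLinearMap ∘ₗ t areaForm)

theorem toPlaneForm_apply (t : TwistedForm (ℂ × ℂ)) (v w : ℂ × ℂ) :
    t.toPlaneForm v w = t areaForm v w := rfl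

theorem apply_eq_mul_toPlaneForm (t : TwistedForm (ℂ × ℂ)) (η : (ℂ × ℂ) [⋀^Fin 2]→ₗ[ℂ] ℂ)
    (v w : ℂ × ℂ) : t η v w = η ![(1, 0), (0, 1)] * t.toPlaneForm v w := by
  conv_lhs => rw [eq_smul_areaForm η]
  simp only [map_smul, LinearMap.smul_apply, smul_eq_mul, toPlaneForm_apply]

theorem toPlaneForm_injective : Function.Injective toPlaneForm := by
  intro t t' h
  refine LinearMap.ext fun η => LinearMap.ext fun v => LinearMap.ext fun w => ?_
  rw [apply_eq_mul_toPlaneForm, apply_eq_mul_toPlaneForm, h]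

theorem toPlaneForm_toTwistedForm (B : PlaneForm) : B.toTwistedForm.toPlaneForm = B := by
  refine ContinuousLinearMap.ext fun v => ContinuousLinearMap.ext fun w => ?_
  rw [toPlaneForm_apply, PlaneForm.toTwistedForm_apply, areaForm_apply]
  simp

theorem det_endo (t : TwistedForm (ℂ × ℂ)) : LinearMap.det t.endo = t.toPlaneForm.disc := by
  rw [← LinearMap.det_toMatrix (Module.Basis.finTwoProd ℂ), Matrix.det_fin_two]
  simp only [LinearMap.toMatrix_apply, endo_apply, PlaneForm.disc, toPlaneForm_apply]
  simp
  ring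

end TwistedForm

/-- The map `L z` depends linearly on its two values at the standard basis vectors. -/
theorem differentiableAt_clm_of_apply {V E : Type*} [NormedAddCommGroup V] [NormedSpace ℂ V]
    [NormedAddCommGroup E] [NormedSpace ℂ E] {L : V → (ℂ × ℂ) →L[ℂ] E} {z : V}
    (h : ∀ v, DifferentiableAt ℂ (fun z => L z v) z) : DifferentiableAt ℂ L z := by
  have hL : L = fun z => ContinuousLinearMap.smulRightL ℂ (ℂ × ℂ) E
      (ContinuousLinearMap.fst ℂ ℂ ℂ) (L z (1, 0)) + ContinuousLinearMap.smulRightL ℂ (ℂ × ℂ) E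
      (ContinuousLinearMap.snd ℂ ℂ ℂ) (L z (0, 1)) :=
    funext fun z => ContinuousLinearMap.ext fun v => clm_plane_apply (L z) v
  rw [hL]
  exact (((ContinuousLinearMap.smulRightL ℂ (ℂ × ℂ) E _).differentiableAt).comp z (h _)).add
    (((ContinuousLinearMap.smulRightL ℂ (ℂ × ℂ) E _).differentiableAt).comp z (h _))

open Filter Topology in
theorem eventually_map_nhds_symm {Y : Type*} [TopologicalSpace Y] {y : Y}
{e' : OpenPartialHomeomorph Y (ℂ × ℂ)}
    (hy : y ∈ e'.source) {P : Y → Prop} (h : ∀ᶠ y' in 𝓝 y, P y') :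
    ∀ᶠ z in 𝓝 (e' y), z ∈ e'.target ∧ P (e'.symm z) := by
  refine (e'.open_target.eventually_mem (e'.map_source hy)).and ?_
  refine (e'.continuousAt_symm (e'.map_source hy)).eventually ?_
  rwa [e'.left_inv hy]

open Filter Topology in
theorem frequently_map_nhds_symm {Y : Type*} [TopologicalSpace Y] {y : Y}
    {e' : OpenPartialHomeomorph Y (ℂ × ℂ)}
    (hy : y ∈ e'.source) {P : Y → Prop} (h : ∃ᶠ y' in 𝓝 y, P y') :
    ∃ᶠ z in 𝓝 (e' y), P (e'.symm z) := by
  rw [← e'.map_nhds_eq hy, frequently_map]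
  refine (h.and_eventually (e'.open_source.eventually_mem hy)).mono fun y' hy' => ?_
  rw [e'.left_inv hy'.2]
  exact hy'.1

/-! ### Holomorphic sections in charts, their pull-back and extension -/

section SurfaceForms

open Filter Topology

variable {X : Type*} [TopologicalSpace X] [ChartedSpace (ℂ × ℂ) X]
variable {Y : Type*} [TopologicalSpace Y] [ChartedSpace (ℂ × ℂ) Y]
variable {Z : Type*} [TopologicalSpace Z] [ChartedSpace (ℂ × ℂ) Z]

/-- The derivative at `y` of a map between surfaces, as an endomorphism of `ℂ × ℂ`. -/
def derivAt (f : Y → X) (y : Y) : (ℂ × ℂ) →L[ℂ] (ℂ × ℂ) :=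
  mfderiv 𝓘(ℂ, ℂ × ℂ) 𝓘(ℂ, ℂ × ℂ) f y

theorem derivAt_comp {g : X → Z} {f : Y → X} {y : Y}
    (hg : MDifferentiableAt 𝓘(ℂ, ℂ × ℂ) 𝓘(ℂ, ℂ × ℂ) g (f y))
    (hf : MDifferentiableAt 𝓘(ℂ, ℂ × ℂ) 𝓘(ℂ, ℂ × ℂ) f y) :
    derivAt (g ∘ f) y = (derivAt g (f y)).comp (derivAt f y) :=
  mfderiv_comp y hg hf

theorem derivAt_id (y : Y) : derivAt (id : Y → Y) y = ContinuousLinearMap.id ℂ (ℂ × ℂ) :=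
  mfderiv_id

theorem derivAt_congr {f g : Y → X} {y : Y} (h : f =ᶠ[𝓝 y] g) : derivAt f y = derivAt g y :=
  h.mfderiv_eq

theorem derivAt_eq_fderiv (f : ℂ × ℂ → ℂ × ℂ) (z : ℂ × ℂ) : derivAt f z = fderiv ℂ f z :=
  mfderiv_eq_fderiv

theorem derivAt_comp_eq_id {g : X → Y} {f : Y → X} {y : Y}
    (hg : MDifferentiableAt 𝓘(ℂ, ℂ × ℂ) 𝓘(ℂ, ℂ × ℂ) g (f y))
    (hf : MDifferentiableAt 𝓘(ℂ, ℂ × ℂ) 𝓘(ℂ, ℂ × ℂ) f y) (h : ∀ᶠ y' in 𝓝 y, g (f y') = y') :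
    (derivAt g (f y)).comp (derivAt f y) = ContinuousLinearMap.id ℂ (ℂ × ℂ) := by
  rw [← derivAt_comp hg hf, ← derivAt_id y]
  exact derivAt_congr h

theorem planeDet_derivAt_ne_zero {g : X → Y} {f : Y → X} {y : Y}
    (hg : MDifferentiableAt 𝓘(ℂ, ℂ × ℂ) 𝓘(ℂ, ℂ × ℂ) g (f y))
    (hf : MDifferentiableAt 𝓘(ℂ, ℂ × ℂ) 𝓘(ℂ, ℂ × ℂ) f y) (h : ∀ᶠ y' in 𝓝 y, g (f y') = y') :
    planeDet (derivAt f y) ≠ 0 := by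
  intro h0
  have := congrArg planeDet (derivAt_comp_eq_id hg hf h)
  rw [planeDet_comp, planeDet_id, h0, mul_zero] at this
  exact zero_ne_one this

variable {e : OpenPartialHomeomorph X (ℂ × ℂ)} {x : X} {z : ℂ × ℂ}

theorem mdifferentiableAt_of_mem_atlas (he : e ∈ IsManifold.maximalAtlas 𝓘(ℂ, ℂ × ℂ) ω X)
    (hx : x ∈ e.source) : MDifferentiableAt 𝓘(ℂ, ℂ × ℂ) 𝓘(ℂ, ℂ × ℂ) e x :=
  (contMDiffAt_of_mem_maximalAtlas he hx).mdifferentiableAt (by simp)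

theorem mdifferentiableAt_symm_of_mem_atlas (he : e ∈ IsManifold.maximalAtlas 𝓘(ℂ, ℂ × ℂ) ω X)
    (hz : z ∈ e.target) : MDifferentiableAt 𝓘(ℂ, ℂ × ℂ) 𝓘(ℂ, ℂ × ℂ) e.symm z :=
  (contMDiffAt_symm_of_mem_maximalAtlas he hz).mdifferentiableAt (by simp)

theorem derivAt_chart_comp_symm (he : e ∈ IsManifold.maximalAtlas 𝓘(ℂ, ℂ × ℂ) ω X)
    (hz : z ∈ e.target) :
    (derivAt e (e.symm z)).comp (derivAt e.symm z) = ContinuousLinearMap.id ℂ (ℂ × ℂ) :=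
  derivAt_comp_eq_id (mdifferentiableAt_of_mem_atlas he (e.map_target hz))
    (mdifferentiableAt_symm_of_mem_atlas he hz)
    ((e.open_target.eventually_mem hz).mono fun _ h => e.right_inv h)

theorem derivAt_symm_comp_chart (he : e ∈ IsManifold.maximalAtlas 𝓘(ℂ, ℂ × ℂ) ω X)
    (hx : x ∈ e.source) :
    (derivAt e.symm (e x)).comp (derivAt e x) = ContinuousLinearMap.id ℂ (ℂ × ℂ) :=
  derivAt_comp_eq_id (mdifferentiableAt_symm_of_mem_atlas he (e.map_source hx))
    (mdifferentiableAt_of_mem_atlas he hx)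
    ((e.open_source.eventually_mem hx).mono fun _ h => e.left_inv h)

theorem planeDet_mul_planeDet_symm (he : e ∈ IsManifold.maximalAtlas 𝓘(ℂ, ℂ × ℂ) ω X)
    (hz : z ∈ e.target) : planeDet (derivAt e (e.symm z)) * planeDet (derivAt e.symm z) = 1 := by
  rw [← planeDet_comp, derivAt_chart_comp_symm he hz, planeDet_id]

theorem planeDet_symm_ne_zero (he : e ∈ IsManifold.maximalAtlas 𝓘(ℂ, ℂ × ℂ) ω X)
    (hz : z ∈ e.target) : planeDet (derivAt e.symm z) ≠ 0 :=
  right_ne_zero_of_mul_eq_one (planeDet_mul_planeDet_symm he hz)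

/-- The tensor `β / (dz₁ ∧ dz₂)` in the coordinates `e`. -/
def chartForm (β : X → PlaneForm) (e : OpenPartialHomeomorph X (ℂ × ℂ)) (z : ℂ × ℂ) : PlaneForm :=
  PlaneForm.pull (derivAt e.symm z) (β (e.symm z))

theorem pull_chartForm (β : X → PlaneForm) (he : e ∈ IsManifold.maximalAtlas 𝓘(ℂ, ℂ × ℂ) ω X)
    (hx : x ∈ e.source) : PlaneForm.pull (derivAt e x) (chartForm β e (e x)) = β x := by
  rw [chartForm, ← PlaneForm.pull_comp, derivAt_symm_comp_chart he hx, PlaneForm.pull_id,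
    e.left_inv hx]

/-- `β` defines a holomorphic section at `x`. -/
def HolAt (β : X → PlaneForm) (x : X) : Prop :=
  ∀ e ∈ IsManifold.maximalAtlas 𝓘(ℂ, ℂ × ℂ) ω X, x ∈ e.source →
    DifferentiableAt ℂ (chartForm β e) (e x)

/-- The coordinate expression of a pull-back. -/
theorem chartForm_pull {f : Y → X} {y : Y} {β : X → PlaneForm} {β' : Y → PlaneForm}
    {e' : OpenPartialHomeomorph Y (ℂ × ℂ)}
    (he' : e' ∈ IsManifold.maximalAtlas 𝓘(ℂ, ℂ × ℂ) ω Y) (hy : y ∈ e'.source)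
    (he : e ∈ IsManifold.maximalAtlas 𝓘(ℂ, ℂ × ℂ) ω X) (hfy : f y ∈ e.source)
    (hf : MDifferentiableAt 𝓘(ℂ, ℂ × ℂ) 𝓘(ℂ, ℂ × ℂ) f y)
    (hβ : β' y = PlaneForm.pull (derivAt f y) (β (f y))) :
    chartForm β' e' (e' y) =
      PlaneForm.pull (fderiv ℂ (e ∘ f ∘ e'.symm) (e' y)) (chartForm β e (e (f y))) := by
  have hz := e'.map_source hy
  have hs := mdifferentiableAt_symm_of_mem_atlas he' hz
  have hl := e'.left_inv hy
  have hf' : MDifferentiableAt 𝓘(ℂ, ℂ × ℂ) 𝓘(ℂ, ℂ × ℂ) f (e'.symm (e' y)) := by rwa [hl]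
  have he1 : MDifferentiableAt 𝓘(ℂ, ℂ × ℂ) 𝓘(ℂ, ℂ × ℂ) e ((f ∘ e'.symm) (e' y)) := by
    rw [Function.comp_apply, hl]
    exact mdifferentiableAt_of_mem_atlas he hfy
  rw [← derivAt_eq_fderiv, derivAt_comp he1 (hf'.comp _ hs), derivAt_comp hf' hs, chartForm,
    PlaneForm.pull_comp, PlaneForm.pull_comp, Function.comp_apply, hl, hβ, pull_chartForm β he hfy]

theorem planeDet_fderiv_in_charts_ne_zero {f : Y → X} {y : Y}
    {e' : OpenPartialHomeomorph Y (ℂ × ℂ)}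
    (he' : e' ∈ IsManifold.maximalAtlas 𝓘(ℂ, ℂ × ℂ) ω Y) (hy : y ∈ e'.source)
    (he : e ∈ IsManifold.maximalAtlas 𝓘(ℂ, ℂ × ℂ) ω X) (hfy : f y ∈ e.source)
    (hf : MDifferentiableAt 𝓘(ℂ, ℂ × ℂ) 𝓘(ℂ, ℂ × ℂ) f y) (hf0 : planeDet (derivAt f y) ≠ 0) :
    planeDet (fderiv ℂ (e ∘ f ∘ e'.symm) (e' y)) ≠ 0 := by
  have hz := e'.map_source hy
  have hs := mdifferentiableAt_symm_of_mem_atlas he' hz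
  have hl := e'.left_inv hy
  have hf' : MDifferentiableAt 𝓘(ℂ, ℂ × ℂ) 𝓘(ℂ, ℂ × ℂ) f (e'.symm (e' y)) := by rwa [hl]
  have he1 : MDifferentiableAt 𝓘(ℂ, ℂ × ℂ) 𝓘(ℂ, ℂ × ℂ) e ((f ∘ e'.symm) (e' y)) := by
    rw [Function.comp_apply, hl]
    exact mdifferentiableAt_of_mem_atlas he hfy
  rw [← derivAt_eq_fderiv, derivAt_comp he1 (hf'.comp _ hs), derivAt_comp hf' hs,
    planeDet_comp, planeDet_comp, Function.comp_apply, hl]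
  refine mul_ne_zero ?_ (mul_ne_zero hf0 (planeDet_symm_ne_zero he' hz))
  have := planeDet_mul_planeDet_symm he (e.map_source hfy)
  rw [e.left_inv hfy] at this
  exact left_ne_zero_of_mul_eq_one this

theorem analyticAt_in_charts {f : Y → X} {y : Y} {e' : OpenPartialHomeomorph Y (ℂ × ℂ)}
    (he' : e' ∈ IsManifold.maximalAtlas 𝓘(ℂ, ℂ × ℂ) ω Y) (hy : y ∈ e'.source)
    (he : e ∈ IsManifold.maximalAtlas 𝓘(ℂ, ℂ × ℂ) ω X) (hfy : f y ∈ e.source)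
    (hf : ContMDiffAt 𝓘(ℂ, ℂ × ℂ) 𝓘(ℂ, ℂ × ℂ) ω f y) :
    AnalyticAt ℂ (e ∘ f ∘ e'.symm) (e' y) := by
  have hs : ContMDiffAt 𝓘(ℂ, ℂ × ℂ) 𝓘(ℂ, ℂ × ℂ) ω e'.symm (e' y) :=
    contMDiffAt_symm_of_mem_maximalAtlas he' (e'.map_source hy)
  have hl := e'.left_inv hy
  have h : ContMDiffAt 𝓘(ℂ, ℂ × ℂ) 𝓘(ℂ, ℂ × ℂ) ω (e ∘ f ∘ e'.symm) (e' y) := by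
    have hf' : ContMDiffAt 𝓘(ℂ, ℂ × ℂ) 𝓘(ℂ, ℂ × ℂ) ω f (e'.symm (e' y)) := by rwa [hl]
    have he1 : ContMDiffAt 𝓘(ℂ, ℂ × ℂ) 𝓘(ℂ, ℂ × ℂ) ω e ((f ∘ e'.symm) (e' y)) := by
      rw [Function.comp_apply, hl]
      exact contMDiffAt_of_mem_maximalAtlas he hfy
    exact he1.comp _ (hf'.comp _ hs)
  exact h.contDiffAt.analyticAt

/-- The pull-back of a holomorphic section under a local biholomorphism is holomorphic. -/
theorem differentiableAt_chartForm_pull {f : Y → X} {y : Y} {β : X → PlaneForm}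
    {β' : Y → PlaneForm} {e' : OpenPartialHomeomorph Y (ℂ × ℂ)}
    (he' : e' ∈ IsManifold.maximalAtlas 𝓘(ℂ, ℂ × ℂ) ω Y) (hy : y ∈ e'.source)
    (he : e ∈ IsManifold.maximalAtlas 𝓘(ℂ, ℂ × ℂ) ω X) (hfy : f y ∈ e.source)
    (hf : ∀ᶠ y' in 𝓝 y, ContMDiffAt 𝓘(ℂ, ℂ × ℂ) 𝓘(ℂ, ℂ × ℂ) ω f y')
    (hf0 : planeDet (derivAt f y) ≠ 0)
    (hβ : ∀ᶠ y' in 𝓝 y, β' y' = PlaneForm.pull (derivAt f y') (β (f y')))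
    (hd : DifferentiableAt ℂ (chartForm β e) (e (f y))) :
    DifferentiableAt ℂ (chartForm β' e') (e' y) := by
  have hfs : ∀ᶠ y' in 𝓝 y, f y' ∈ e.source :=
    hf.self_of_nhds.continuousAt.eventually (e.open_source.mem_nhds hfy)
  have heq : chartForm β' e' =ᶠ[𝓝 (e' y)] fun z =>
      PlaneForm.pull (fderiv ℂ (e ∘ f ∘ e'.symm) z) (chartForm β e ((e ∘ f ∘ e'.symm) z)) := by
    filter_upwards [eventually_map_nhds_symm hy (hf.and (hβ.and hfs))] with z ⟨hz, h1, h2, h3⟩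
    have := chartForm_pull he' (e'.map_target hz) he h3 (h1.mdifferentiableAt (by simp)) h2
    rwa [e'.right_inv hz] at this
  have han := analyticAt_in_charts he' hy he hfy hf.self_of_nhds
  have hfy' : (e ∘ f ∘ e'.symm) (e' y) = e (f y) := by
    simp only [Function.comp_apply, e'.left_inv hy]
  refine DifferentiableAt.congr_of_eventuallyEq ?_ heq
  refine DifferentiableAt.planeForm_pull han.fderiv.differentiableAt ?_ ?_
  · rw [← hfy'] at hd
    exact hd.comp (e' y) han.differentiableAt
  · exact planeDet_fderiv_in_charts_ne_zero he' hy he hfy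
      (hf.self_of_nhds.mdifferentiableAt (by simp)) hf0

/-- A change of charts is a pull-back along the identity map of the surface. -/
theorem HolAt.of_chart [IsManifold 𝓘(ℂ, ℂ × ℂ) ω X] {β : X → PlaneForm}
    (he : e ∈ IsManifold.maximalAtlas 𝓘(ℂ, ℂ × ℂ) ω X) (hx : x ∈ e.source)
    (hd : DifferentiableAt ℂ (chartForm β e) (e x)) : HolAt β x := by
  intro e' he' hx'
  refine differentiableAt_chartForm_pull (f := id) (β := β) he' hx' he hx
    (Eventually.of_forall fun _ => contMDiffAt_id) ?_ (Eventually.of_forall fun y => ?_) hd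
  · rw [derivAt_id, planeDet_id]
    exact one_ne_zero
  · rw [derivAt_id, PlaneForm.pull_id, id]

theorem HolAt.pull [IsManifold 𝓘(ℂ, ℂ × ℂ) ω X] {f : Y → X} {y : Y} {β : X → PlaneForm}
    {β' : Y → PlaneForm} (hd : HolAt β (f y))
    (hf : ∀ᶠ y' in 𝓝 y, ContMDiffAt 𝓘(ℂ, ℂ × ℂ) 𝓘(ℂ, ℂ × ℂ) ω f y')
    (hf0 : planeDet (derivAt f y) ≠ 0)
    (hβ : ∀ᶠ y' in 𝓝 y, β' y' = PlaneForm.pull (derivAt f y') (β (f y'))) : HolAt β' y :=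
  fun _ he' hy => differentiableAt_chartForm_pull he' hy
    (IsManifold.chart_mem_maximalAtlas (f y)) (mem_chart_source _ _) hf hf0 hβ
    (hd _ (IsManifold.chart_mem_maximalAtlas (f y)) (mem_chart_source _ _))

/-- The values `β y` lie in tangent spaces identified with `ℂ × ℂ` point by point, so `β` itself
need not be continuous. The limit is therefore taken for the expressions in a fixed chart and
carried back by `pull_chartForm`. -/
theorem HolAt.eq_of_frequently [IsManifold 𝓘(ℂ, ℂ × ℂ) ω X] {β γ : X → PlaneForm}
    (hβ : HolAt β x) (hγ : HolAt γ x) (h : ∃ᶠ y in 𝓝 x, β y = γ y) : β x = γ x := by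
  have he := IsManifold.chart_mem_maximalAtlas (I := 𝓘(ℂ, ℂ × ℂ)) (n := ω) x
  have hx := mem_chart_source (ℂ × ℂ) x
  rw [← pull_chartForm β he hx, ← pull_chartForm γ he hx]
  congr 1
  refine tendsto_nhds_unique_of_frequently_eq (hβ _ he hx).continuousAt.tendsto
    (hγ _ he hx).continuousAt.tendsto ((frequently_map_nhds_symm hx h).mono fun z hz => ?_)
  rw [chartForm, chartForm, hz]

theorem HolAt.flip {β : X → PlaneForm} (hβ : HolAt β x) : HolAt (fun x => (β x).flip) x :=
  fun e he hx =>
    (ContinuousLinearMap.flipₗᵢ ℂ (ℂ × ℂ) (ℂ × ℂ) ℂ).differentiableAt.comp (e x) (hβ e he hx)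

theorem holAt_zero : HolAt (fun _ : X => (0 : PlaneForm)) x := by
  intro e _ _
  have : chartForm (fun _ : X => (0 : PlaneForm)) e = fun _ => 0 :=
    funext fun z => PlaneForm.pull_zero _
  rw [this]
  exact differentiableAt_const _

/-- A holomorphic section over the complement of `S` extends if it does so in coordinates around
each point of `S`. -/
theorem exists_holAt_extension [IsManifold 𝓘(ℂ, ℂ × ℂ) ω X] {S : Set X} (hS : IsClosed S)
    (hdense : ∀ x ∈ S, ∃ᶠ y in 𝓝 x, y ∉ S) {β₀ : X → PlaneForm} (hβ₀ : ∀ x ∉ S, HolAt β₀ x)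
    (hext : ∀ x ∈ S, ∃ e ∈ IsManifold.maximalAtlas 𝓘(ℂ, ℂ × ℂ) ω X, x ∈ e.source ∧
      ∃ G : ℂ × ℂ → PlaneForm, ∀ᶠ z in 𝓝 (e x),
        DifferentiableAt ℂ G z ∧ (e.symm z ∉ S → chartForm β₀ e z = G z)) :
    ∃ β : X → PlaneForm, (∀ x ∉ S, β x = β₀ x) ∧ ∀ x, HolAt β x := by
  classical
  have hext' : ∀ x, ∃ (e : OpenPartialHomeomorph X (ℂ × ℂ)) (G : ℂ × ℂ → PlaneForm), x ∈ S →
      e ∈ IsManifold.maximalAtlas 𝓘(ℂ, ℂ × ℂ) ω X ∧ x ∈ e.source ∧ ∀ᶠ z in 𝓝 (e x),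
        DifferentiableAt ℂ G z ∧ (e.symm z ∉ S → chartForm β₀ e z = G z) := by
    intro x
    by_cases hx : x ∈ S
    · obtain ⟨e, he, hxe, G, hG⟩ := hext x hx
      exact ⟨e, G, fun _ => ⟨he, hxe, hG⟩⟩
    · exact ⟨chartAt _ x, 0, fun h => absurd h hx⟩
  choose e G hall using hext'
  have he := fun x hx => (hall x hx).1
  have hxe := fun x hx => (hall x hx).2.1
  have hG := fun x hx => (hall x hx).2.2
  -- At a point of `S`, the value is the one prescribed by the extension chosen for that very point;
  -- different choices have to be compared next.
  let β : X → PlaneForm := fun x =>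
    if x ∈ S then PlaneForm.pull (derivAt (e x) x) (G x (e x x)) else β₀ x
  have hoff : ∀ x ∉ S, β x = β₀ x := fun x hx => if_neg hx
  have hon : ∀ x ∈ S, chartForm β (e x) (e x x) = G x (e x x) := by
    intro x hx
    have hl := (e x).left_inv (hxe x hx)
    have h := derivAt_chart_comp_symm (he x hx) ((e x).map_source (hxe x hx))
    rw [hl] at h
    rw [chartForm, hl, show β x = _ from if_pos hx, ← PlaneForm.pull_comp, h, PlaneForm.pull_id]
  have hchart : ∀ x ∈ S, ∀ᶠ z in 𝓝 (e x x), chartForm β (e x) z = G x z := by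
    intro x hx
    filter_upwards [(hG x hx).eventually_nhds,
      (e x).open_target.eventually_mem ((e x).map_source (hxe x hx))] with z hz hzt
    by_cases hzS : (e x).symm z ∈ S
    swap
    · rw [← hz.self_of_nhds.2 hzS, chartForm, chartForm, hoff _ hzS]
    -- For a second point `y` of `S` in the chart of `x`, the extension `G y`, carried over by the
    -- change of coordinates, agrees with `G x` off `S`. Both are continuous at `z` and `S` has no
    -- interior point, so they agree at `z`.
    set y := (e x).symm z with hy
    have hys : y ∈ (e x).source := (e x).map_target hzt
    have hzy : z = e x y := ((e x).right_inv hzt).symm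
    have hid : ∀ w ∈ (e x).target, (e x).symm w ∈ (e y).source → ∀ γ : X → PlaneForm,
        chartForm γ (e x) w = PlaneForm.pull (fderiv ℂ (e y ∘ id ∘ (e x).symm) w)
          (chartForm γ (e y) (e y ((e x).symm w))) := by
      intro w hw hws γ
      have := chartForm_pull (f := id) (β := γ) (β' := γ) (he x hx) ((e x).map_target hw)
        (he y hzS) hws mdifferentiableAt_id (by rw [derivAt_id, PlaneForm.pull_id, id])
      rwa [(e x).right_inv hw] at this
    have han : AnalyticAt ℂ (e y ∘ id ∘ (e x).symm) z := by
      rw [hzy]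
      exact analyticAt_in_charts (he x hx) hys (he y hzS) (hxe y hzS) contMDiffAt_id
    have hT : (e y ∘ id ∘ (e x).symm) z = e y y := rfl
    rw [hid z hzt (hxe y hzS), ← hy, hon y hzS]
    have hGy := hG y hzS
    have hev : ∀ᶠ w in 𝓝 z, (e x).symm w ∉ S → PlaneForm.pull
        (fderiv ℂ (e y ∘ id ∘ (e x).symm) w) (G y ((e y ∘ id ∘ (e x).symm) w)) = G x w := by
      have h1 := han.continuousAt.eventually (hT ▸ hGy)
      have h2 := eventually_map_nhds_symm hys ((e y).open_source.eventually_mem (hxe y hzS))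
      rw [← hzy] at h2
      filter_upwards [h1, h2, hz] with w hw1 hw2 hw3 hwS
      have hyw : (e y).symm ((e y ∘ id ∘ (e x).symm) w) = (e x).symm w := (e y).left_inv hw2.2
      rw [← hw1.2 (by rwa [hyw]), ← hw3.2 hwS]
      exact (hid w hw2.1 hw2.2 β₀).symm
    have hfreq : ∃ᶠ w in 𝓝 z, (e x).symm w ∉ S := by
      rw [hzy]
      exact frequently_map_nhds_symm hys (hdense y hzS)
    have hcont : DifferentiableAt ℂ (fun w => PlaneForm.pull
        (fderiv ℂ (e y ∘ id ∘ (e x).symm) w) (G y ((e y ∘ id ∘ (e x).symm) w))) z := by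
      refine DifferentiableAt.planeForm_pull han.fderiv.differentiableAt ?_ ?_
      · exact DifferentiableAt.comp (g := G y) z (hT ▸ hGy.self_of_nhds.1) han.differentiableAt
      · rw [hzy]
        refine planeDet_fderiv_in_charts_ne_zero (f := id) (he x hx) hys (he y hzS) (hxe y hzS)
          mdifferentiableAt_id ?_
        rw [derivAt_id, planeDet_id]
        exact one_ne_zero
    exact tendsto_nhds_unique_of_frequently_eq hcont.continuousAt.tendsto
      hz.self_of_nhds.1.continuousAt.tendsto ((hfreq.and_eventually hev).mono fun w hw => hw.2 hw.1)
  refine ⟨β, hoff, fun x => ?_⟩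
  by_cases hx : x ∈ S
  · exact .of_chart (he x hx) (hxe x hx)
      ((hG x hx).self_of_nhds.1.congr_of_eventuallyEq (hchart x hx))
  · refine (hβ₀ x hx).pull (f := id) (Eventually.of_forall fun _ => contMDiffAt_id) ?_ ?_
    · rw [derivAt_id, planeDet_id]
      exact one_ne_zero
    · filter_upwards [hS.isOpen_compl.mem_nhds hx] with y hy
      rw [derivAt_id, PlaneForm.pull_id, id, hoff y hy]

/-! ### Twisted tensors as families of bilinear forms -/

/-- The bilinear forms that give a twisted tensor. -/
def TwistedTensor.form (τ : TwistedTensor X) (x : X) : PlaneForm :=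
  TwistedForm.toPlaneForm (τ x)

theorem TwistedTensor.eq_of_form_eq {τ τ' : TwistedTensor X} (h : τ.form x = τ'.form x) :
    τ x = τ' x :=
  TwistedForm.toPlaneForm_injective h

theorem TwistedTensor.form_injective :
    Function.Injective (TwistedTensor.form : TwistedTensor X → X → PlaneForm) :=
  fun _ _ h => funext fun x => eq_of_form_eq (congrFun h x)

theorem TwistedTensor.exists_form_eq (β : X → PlaneForm) : ∃ τ : TwistedTensor X, τ.form = β :=
  ⟨fun x => (β x).toTwistedForm, funext fun x => TwistedForm.toPlaneForm_toTwistedForm (β x)⟩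

theorem TwistedTensor.apply_eq (τ : TwistedTensor X) (x : X)
    (η : (ℂ × ℂ) [⋀^Fin 2]→ₗ[ℂ] ℂ) (v w : ℂ × ℂ) :
    (show TwistedForm (ℂ × ℂ) from τ x) η v w = η ![(1, 0), (0, 1)] * τ.form x v w :=
  TwistedForm.apply_eq_mul_toPlaneForm _ η v w

/-- Pulling `η` back along `e` produces the determinant of its derivative, which is the inverse of
that of `e.symm`: exactly the factor in `PlaneForm.pull`. -/
theorem TwistedTensor.inChart_eq (τ : TwistedTensor X)
    (he : e ∈ IsManifold.maximalAtlas 𝓘(ℂ, ℂ × ℂ) ω X) (hz : z ∈ e.target)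
    (η : (ℂ × ℂ) [⋀^Fin 2]→ₗ[ℂ] ℂ) (v w : ℂ × ℂ) :
    τ.inChart e z η v w = η ![(1, 0), (0, 1)] * chartForm τ.form e z v w := by
  have h1 : τ.inChart e z η v w = (η.compLinearMap (derivAt e (e.symm z)).toLinearMap)
      ![(1, 0), (0, 1)] * τ.form (e.symm z) (derivAt e.symm z v) (derivAt e.symm z w) :=
    τ.apply_eq _ _ _ _
  have h2 : (η.compLinearMap (derivAt e (e.symm z)).toLinearMap) ![(1, 0), (0, 1)] =
      η ![derivAt e (e.symm z) (1, 0), derivAt e (e.symm z) (0, 1)] := by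
    rw [AlternatingMap.compLinearMap_apply]
    congr 1
    ext i <;> fin_cases i <;> rfl
  rw [h1, h2, alternatingMap_apply_clm, chartForm, PlaneForm.pull_apply,
    eq_inv_of_mul_eq_one_left (planeDet_mul_planeDet_symm he hz)]
  ring

/-- One two-form, `areaForm`, suffices to test symmetry and holomorphy, as all others are multiples
of it. -/
theorem isSpecialTensor_iff [IsManifold 𝓘(ℂ, ℂ × ℂ) ω X] {τ : TwistedTensor X} :
    IsSpecialTensor τ ↔ (∀ x, (τ.form x).flip = τ.form x) ∧ (∀ x, HolAt τ.form x) ∧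
      τ.form ≠ fun _ => 0 := by
  have harea : areaForm ![(1, 0), (0, 1)] = 1 := by simp [areaForm_apply]
  constructor
  · intro h
    refine ⟨fun x => ContinuousLinearMap.ext fun v => ContinuousLinearMap.ext fun w =>
      h.symm x areaForm w v, fun x e he hx => ?_, fun h0 => h.ne_zero ?_⟩
    · have hz := e.map_source hx
      have hd : ∀ v w, DifferentiableAt ℂ (fun z => chartForm τ.form e z v w) (e x) := by
        intro v w
        refine DifferentiableAt.congr_of_eventuallyEq ((h.holomorphic e he areaForm v
          w).differentiableAt (e.open_target.mem_nhds hz)) ?_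
        filter_upwards [e.open_target.mem_nhds hz] with z hz
        rw [τ.inChart_eq he hz, harea, one_mul]
      exact differentiableAt_clm_of_apply fun v => differentiableAt_clm_of_apply fun w => hd v w
    · exact TwistedTensor.form_injective h0
  · rintro ⟨hs, hh, hn⟩
    refine ⟨fun x η v w => ?_, fun e he η v w z hz => ?_, fun h0 => hn (h0 ▸ rfl)⟩
    · have h : τ.form x v w = τ.form x w v := by
        conv_lhs => rw [← hs x]
        rfl
      exact (τ.apply_eq x η v w).trans
        ((congrArg (η ![(1, 0), (0, 1)] * ·) h).trans (τ.apply_eq x η w v).symm)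
    · have hd := hh (e.symm z) e he (e.map_target hz)
      rw [e.right_inv hz] at hd
      refine (DifferentiableAt.congr_of_eventuallyEq (((hd.clm_apply
        (differentiableAt_const v)).clm_apply (differentiableAt_const w)).const_mul
          (η ![(1, 0), (0, 1)])) ?_).differentiableWithinAt
      filter_upwards [e.open_target.mem_nhds hz] with z hz
      exact τ.inChart_eq he hz η v w

/-- The pull-back of `η` carries the factor `planeDet (derivAt f y)`; where it is nonzero it can be
moved to the other side, which gives `PlaneForm.pull`. -/
theorem correspondOff_iff {f : Y → X} {p : X} {τ' : TwistedTensor Y} {τ : TwistedTensor X}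
    (hf : ∀ y, f y ≠ p → planeDet (derivAt f y) ≠ 0) :
    CorrespondOff f p τ' τ ↔
      ∀ y, f y ≠ p → τ'.form y = PlaneForm.pull (derivAt f y) (τ.form (f y)) := by
  have key : ∀ y (η : (ℂ × ℂ) [⋀^Fin 2]→ₗ[ℂ] ℂ) (v w : ℂ × ℂ),
      (show TwistedForm (ℂ × ℂ) from τ' y) (η.compLinearMap (derivAt f y).toLinearMap) v w =
        η ![(1, 0), (0, 1)] * planeDet (derivAt f y) * τ'.form y v w := by
    intro y η v w
    rw [τ'.apply_eq, ← alternatingMap_apply_clm, AlternatingMap.compLinearMap_apply]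
    congr 2
    ext i <;> fin_cases i <;> rfl
  refine forall₂_congr fun y hy => ?_
  have h0 := hf y hy
  constructor
  · intro h
    refine ContinuousLinearMap.ext fun v => ContinuousLinearMap.ext fun w => ?_
    have h1 : planeDet (derivAt f y) * τ'.form y v w =
        τ.form (f y) (derivAt f y v) (derivAt f y w) := by
      have := (key y areaForm v w).symm.trans
        ((h areaForm v w).trans (τ.apply_eq (f y) areaForm (derivAt f y v) (derivAt f y w)))
      simpa [areaForm_apply] using this
    rw [PlaneForm.pull_apply, ← h1, inv_mul_cancel_left₀ h0]
  · intro h η v w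
    refine (key y η v w).trans (Eq.trans ?_
      (τ.apply_eq (f y) η (derivAt f y v) (derivAt f y w)).symm)
    have h2 : τ'.form y v w =
        (planeDet (derivAt f y))⁻¹ * τ.form (f y) (derivAt f y v) (derivAt f y w) := by
      rw [h]
      rfl
    rw [h2, mul_assoc, mul_inv_cancel_left₀ h0]

end SurfaceForms

/-! ### Descent and lifting along the blowup -/

section Blowup

open Filter Topology

theorem frequently_fst_ne (q : ℂ × ℂ) (c : ℂ) : ∃ᶠ q' in 𝓝 q, q'.1 ≠ c := by
  intro h
  have h1 : Tendsto (fun t : ℂ => (t, q.2)) (𝓝 q.1) (𝓝 q) :=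
    (by fun_prop : Continuous fun t : ℂ => (t, q.2)).tendsto q.1
  have h2 : ∀ᶠ t in 𝓝 q.1, t = c := (h1.eventually h).mono fun _ ht => not_not.1 ht
  obtain ⟨t, ht, htc⟩ := ((eventually_nhdsWithin_of_eventually_nhds h2).and
    (self_mem_nhdsWithin : {q.1}ᶜ ∈ 𝓝[≠] q.1)).exists
  exact htc (ht.trans h2.self_of_nhds.symm)

theorem frequently_snd_ne (q : ℂ × ℂ) (c : ℂ) : ∃ᶠ q' in 𝓝 q, q'.2 ≠ c := fun h =>
  frequently_fst_ne q.swap c ((continuous_swap.tendsto q.swap).eventually h)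

/-- The blowup of the origin of `ℂ × ℂ` in the coordinates `(x, u)`. -/
def blowupFst (q : ℂ × ℂ) : ℂ × ℂ := (q.1, q.1 * q.2)

/-- The blowup of the origin of `ℂ × ℂ` in the coordinates `(v, y)`. -/
def blowupSnd (q : ℂ × ℂ) : ℂ × ℂ := (q.1 * q.2, q.2)

theorem analyticAt_blowupFst (q : ℂ × ℂ) : AnalyticAt ℂ blowupFst q :=
  analyticAt_fst.prod (analyticAt_fst.mul analyticAt_snd)

theorem analyticAt_blowupSnd (q : ℂ × ℂ) : AnalyticAt ℂ blowupSnd q :=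
  (analyticAt_fst.mul analyticAt_snd).prod analyticAt_snd

theorem fderiv_blowupFst_apply (q v : ℂ × ℂ) :
    fderiv ℂ blowupFst q v = (v.1, q.1 * v.2 + q.2 * v.1) := by
  have h : HasFDerivAt blowupFst _ q :=
    (hasFDerivAt_fst (𝕜 := ℂ) (p := q)).prodMk (hasFDerivAt_fst.mul hasFDerivAt_snd)
  rw [h.fderiv]
  simp

theorem fderiv_blowupSnd_apply (q v : ℂ × ℂ) :
    fderiv ℂ blowupSnd q v = (q.1 * v.2 + q.2 * v.1, v.2) := by
  have h : HasFDerivAt blowupSnd _ q :=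
    (hasFDerivAt_fst.mul hasFDerivAt_snd).prodMk (hasFDerivAt_snd (𝕜 := ℂ) (p := q))
  rw [h.fderiv]
  simp

theorem planeDet_fderiv_blowupFst (q : ℂ × ℂ) : planeDet (fderiv ℂ blowupFst q) = q.1 := by
  simp [planeDet, fderiv_blowupFst_apply]

theorem planeDet_fderiv_blowupSnd (q : ℂ × ℂ) : planeDet (fderiv ℂ blowupSnd q) = q.2 := by
  simp [planeDet, fderiv_blowupSnd_apply]

/-- In coordinates the exceptional curve is the zero set of `P`, since `φ` is injective and sends
`p` to `0`. -/
theorem map_eq_center_iff {X X' : Type*} [TopologicalSpace X] [TopologicalSpace X'] {π : X' → X}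
    {p : X} {φ : OpenPartialHomeomorph X (ℂ × ℂ)} {ψ : OpenPartialHomeomorph X' (ℂ × ℂ)}
    {P : ℂ × ℂ → ℂ × ℂ} {q : ℂ × ℂ} (hp : p ∈ φ.source) (h0 : φ p = 0)
    (hsub : ∀ x ∈ ψ.source, π x ∈ φ.source) (hP : ∀ x ∈ ψ.source, φ (π x) = P (ψ x))
    (hq : q ∈ ψ.target) : π (ψ.symm q) = p ↔ P q = 0 := by
  have hs := ψ.map_target hq
  rw [← φ.injOn.eq_iff (hsub _ hs) hp, h0, hP _ hs, ψ.right_inv hq]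

variable {X : Type*} [TopologicalSpace X] [ChartedSpace (ℂ × ℂ) X]
variable {X' : Type*} [TopologicalSpace X'] [ChartedSpace (ℂ × ℂ) X']

theorem frequently_nhds_ne (x p : X) : ∃ᶠ y in 𝓝 x, y ≠ p := by
  intro h
  have hx := mem_chart_source (ℂ × ℂ) x
  refine frequently_fst_ne (chartAt (ℂ × ℂ) x x) (chartAt (ℂ × ℂ) x p).1
    ((eventually_map_nhds_symm hx h).mono fun z hz => not_not.2 ?_)
  rw [← not_not.1 hz.2, (chartAt (ℂ × ℂ) x).right_inv hz.1]

variable {π : X' → X} {p : X} {φ : OpenPartialHomeomorph X (ℂ × ℂ)}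
  {ψ : OpenPartialHomeomorph X' (ℂ × ℂ)} {P : ℂ × ℂ → ℂ × ℂ} {q : ℂ × ℂ}

/-- The pull-back of `β` in coordinates in which the map is `P`, times the determinant of `P`. -/
def pullNumerator (β : X → PlaneForm) (φ : OpenPartialHomeomorph X (ℂ × ℂ))
    (P : ℂ × ℂ → ℂ × ℂ) (q : ℂ × ℂ) : PlaneForm :=
  (chartForm β φ (P q)).bilinearComp (fderiv ℂ P q) (fderiv ℂ P q)

theorem differentiableAt_pullNumerator {β : X → PlaneForm} (hβ : ∀ x, HolAt β x)
    (hφ : φ ∈ IsManifold.maximalAtlas 𝓘(ℂ, ℂ × ℂ) ω X) (hP : AnalyticAt ℂ P q)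
    (hq : P q ∈ φ.target) : DifferentiableAt ℂ (pullNumerator β φ P) q := by
  have h := hβ _ φ hφ (φ.map_target hq)
  rw [φ.right_inv hq] at h
  exact hP.fderiv.differentiableAt.bilinearComp (h.comp q hP.differentiableAt)

/-- This confines the possible pole of a lift to the scalar factor, which is `x⁻¹` or `y⁻¹` for the
two blowup charts. -/
theorem chartForm_eq_pullNumerator {β : X → PlaneForm} {β' : X' → PlaneForm}
    (hφ : φ ∈ IsManifold.maximalAtlas 𝓘(ℂ, ℂ × ℂ) ω X)
    (hψ : ψ ∈ IsManifold.maximalAtlas 𝓘(ℂ, ℂ × ℂ) ω X')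
    (hπ : ContMDiff 𝓘(ℂ, ℂ × ℂ) 𝓘(ℂ, ℂ × ℂ) ω π)
    (hsub : ∀ x ∈ ψ.source, π x ∈ φ.source) (hP : ∀ x ∈ ψ.source, φ (π x) = P (ψ x))
    (hq : q ∈ ψ.target)
    (hβ : β' (ψ.symm q) = PlaneForm.pull (derivAt π (ψ.symm q)) (β (π (ψ.symm q)))) :
    chartForm β' ψ q = (planeDet (fderiv ℂ P q))⁻¹ • pullNumerator β φ P q := by
  have hs := ψ.map_target hq
  have h := chartForm_pull hψ hs hφ (hsub _ hs) (hπ.mdifferentiableAt (by simp)) hβ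
  have heq : φ ∘ π ∘ ψ.symm =ᶠ[𝓝 q] P := by
    filter_upwards [ψ.open_target.mem_nhds hq] with q hq
    rw [Function.comp_apply, Function.comp_apply, hP _ (ψ.map_target hq), ψ.right_inv hq]
  rw [hP _ hs, ψ.right_inv hq, heq.fderiv_eq] at h
  exact h

namespace IsBlowup

theorem planeDet_ne_zero [T1Space X] (hπ : IsBlowup π p) {x : X'} (hx : π x ≠ p) :
    planeDet (derivAt π x) ≠ 0 := by
  obtain ⟨σ, hσ, -, hσπ⟩ := hπ.exists_inverse
  exact planeDet_derivAt_ne_zero (g := σ) ((hσ.contMDiffAt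
    (isOpen_compl_singleton.mem_nhds hx)).mdifferentiableAt (by simp))
    (hπ.holomorphic.mdifferentiableAt (by simp))
    ((hπ.holomorphic.continuous.continuousAt.eventually_ne hx).mono hσπ)

/-- Around a point over `p`, the blowup is given in coordinates by `blowupFst` or `blowupSnd`. -/
theorem exists_chart (hπ : IsBlowup π p) {x : X'} (hx : π x = p) :
    ∃ φ ∈ IsManifold.maximalAtlas 𝓘(ℂ, ℂ × ℂ) ω X,
    ∃ ψ ∈ IsManifold.maximalAtlas 𝓘(ℂ, ℂ × ℂ) ω X', p ∈ φ.source ∧ φ p = 0 ∧ x ∈ ψ.source ∧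
      (∀ x ∈ ψ.source, π x ∈ φ.source) ∧
      ((∀ x ∈ ψ.source, φ (π x) = blowupFst (ψ x)) ∨
        ∀ x ∈ ψ.source, φ (π x) = blowupSnd (ψ x)) := by
  obtain ⟨φ, hφ, ψ₀, hψ₀, ψ₁, hψ₁, hp, h0, hU, -, -, hP₀, hP₁, -⟩ := hπ.exists_charts
  have hxU : x ∈ ψ₀.source ∪ ψ₁.source := by
    rw [hU, Set.mem_preimage, hx]
    exact hp
  rcases hxU with hx | hx
  · exact ⟨φ, hφ, ψ₀, hψ₀, hp, h0, hx, fun y hy => hU.le (Or.inl hy), Or.inl hP₀⟩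
  · exact ⟨φ, hφ, ψ₁, hψ₁, hp, h0, hx, fun y hy => hU.le (Or.inr hy), Or.inr hP₁⟩

theorem frequently_ne (hπ : IsBlowup π p) {x : X'} (hx : π x = p) : ∃ᶠ y in 𝓝 x, π y ≠ p := by
  obtain ⟨φ, hφ, ψ, hψ, hp, h0, hxψ, hsub, hP⟩ := hπ.exists_chart hx
  intro h
  have h' := eventually_map_nhds_symm hxψ h
  rcases hP with hP | hP
  · refine frequently_fst_ne (ψ x) 0 (h'.mono fun q hq => not_not.2 ?_)
    exact congrArg Prod.fst ((map_eq_center_iff hp h0 hsub hP hq.1).1 (not_not.1 hq.2))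
  · refine frequently_snd_ne (ψ x) 0 (h'.mono fun q hq => not_not.2 ?_)
    exact congrArg Prod.snd ((map_eq_center_iff hp h0 hsub hP hq.1).1 (not_not.1 hq.2))

/-- A holomorphic section that vanishes at `p` lifts to the blowup. -/
theorem exists_lift [IsManifold 𝓘(ℂ, ℂ × ℂ) ω X] [IsManifold 𝓘(ℂ, ℂ × ℂ) ω X'] [T1Space X]
    (hπ : IsBlowup π p) {β : X → PlaneForm} (hβ : ∀ x, HolAt β x) (h0 : β p = 0) :
    ∃ β' : X' → PlaneForm, (∀ x, HolAt β' x) ∧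
      ∀ x, π x ≠ p → β' x = PlaneForm.pull (derivAt π x) (β (π x)) := by
  have hc := hπ.holomorphic.continuous
  refine (exists_holAt_extension (S := π ⁻¹' {p})
    (β₀ := fun x => PlaneForm.pull (derivAt π x) (β (π x))) (isClosed_singleton.preimage hc)
    (fun x hx => hπ.frequently_ne hx)
    (fun x hx => (hβ (π x)).pull (Eventually.of_forall fun y => hπ.holomorphic y)
      (hπ.planeDet_ne_zero hx) (Eventually.of_forall fun _ => rfl)) ?_).imp
    fun β' ⟨hoff, hhol⟩ => ⟨hhol, hoff⟩
  intro x hx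
  obtain ⟨φ, hφ, ψ, hψ, hp, hφp, hxψ, hsub, hP⟩ := hπ.exists_chart hx
  refine ⟨ψ, hψ, hxψ, ?_⟩
  -- The vanishing at `p` enters here: it makes the numerator vanish along the whole exceptional
  -- curve, so that it is divisible by the Jacobian determinant.
  have hchart0 : chartForm β φ 0 = 0 := by
    rw [← hφp, chartForm, φ.left_inv hp, h0, PlaneForm.pull_zero]
  have hN : ∀ P : ℂ × ℂ → ℂ × ℂ, (∀ q, AnalyticAt ℂ P q) →
      (∀ x ∈ ψ.source, φ (π x) = P (ψ x)) → ∀ᶠ q in 𝓝 (ψ x),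
        DifferentiableAt ℂ (pullNumerator β φ P) q ∧ (P q = 0 → pullNumerator β φ P q = 0) := by
    intro P hPa hP
    filter_upwards [ψ.open_target.mem_nhds (ψ.map_source hxψ)] with q hq
    refine ⟨differentiableAt_pullNumerator hβ hφ (hPa q) ?_, fun hPq => ?_⟩
    · rw [← ψ.right_inv hq, ← hP _ (ψ.map_target hq)]
      exact φ.map_source (hsub _ (ψ.map_target hq))
    · rw [pullNumerator, hPq, hchart0]
      rfl
  have hPx : ∀ P : ℂ × ℂ → ℂ × ℂ, (∀ x ∈ ψ.source, φ (π x) = P (ψ x)) → P (ψ x) = 0 := by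
    intro P hP
    refine (map_eq_center_iff hp hφp hsub hP (ψ.map_source hxψ)).1 ?_
    rwa [ψ.left_inv hxψ]
  rcases hP with hP | hP
  · have hx0 : (0, (ψ x).2) = ψ x :=
      Prod.ext (congrArg Prod.fst (hPx _ hP)).symm rfl
    obtain ⟨G, hG⟩ := exists_differentiableAt_eq_inv_fst_smul (N := pullNumerator β φ blowupFst)
      (b := (ψ x).2) (by
        rw [hx0]
        filter_upwards [hN _ analyticAt_blowupFst hP] with q hq
        exact ⟨hq.1, fun h => hq.2 (by simp [blowupFst, h])⟩)
    rw [hx0] at hG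
    refine ⟨G, ?_⟩
    filter_upwards [hG, ψ.open_target.mem_nhds (ψ.map_source hxψ)] with q hq hqt
    refine ⟨hq.1, fun hqp => ?_⟩
    rw [← hq.2 fun h => hqp ((map_eq_center_iff hp hφp hsub hP hqt).2 (by simp [blowupFst, h])),
      chartForm_eq_pullNumerator hφ hψ hπ.holomorphic hsub hP hqt rfl, planeDet_fderiv_blowupFst]
  · have hx0 : ((ψ x).1, 0) = ψ x :=
      Prod.ext rfl (congrArg Prod.snd (hPx _ hP)).symm
    obtain ⟨G, hG⟩ := exists_differentiableAt_eq_inv_snd_smul (N := pullNumerator β φ blowupSnd)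
      (b := (ψ x).1) (by
        rw [hx0]
        filter_upwards [hN _ analyticAt_blowupSnd hP] with q hq
        exact ⟨hq.1, fun h => hq.2 (by simp [blowupSnd, h])⟩)
    rw [hx0] at hG
    refine ⟨G, ?_⟩
    filter_upwards [hG, ψ.open_target.mem_nhds (ψ.map_source hxψ)] with q hq hqt
    refine ⟨hq.1, fun hqp => ?_⟩
    rw [← hq.2 fun h => hqp ((map_eq_center_iff hp hφp hsub hP hqt).2 (by simp [blowupSnd, h])),
      chartForm_eq_pullNumerator hφ hψ hπ.holomorphic hsub hP hqt rfl, planeDet_fderiv_blowupSnd]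

/-- A symmetric holomorphic section that lifts to the blowup vanishes at `p`. -/
theorem eq_zero_of_lift (hπ : IsBlowup π p) {β : X → PlaneForm} (hβ : ∀ x, HolAt β x)
    (hs : (β p).flip = β p) {β' : X' → PlaneForm} (hβ' : ∀ x, HolAt β' x)
    (h : ∀ x, π x ≠ p → β' x = PlaneForm.pull (derivAt π x) (β (π x))) : β p = 0 := by
  obtain ⟨φ, hφ, ψ, hψ, _, _, hp, h0, hU, htarget, -, hP, -⟩ := hπ.exists_charts
  change ∀ x ∈ ψ.source, φ (π x) = blowupFst (ψ x) at hP
  have hsub : ∀ x ∈ ψ.source, π x ∈ φ.source := fun x hx => hU.le (Or.inl hx)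
  have hφ0 : (0 : ℂ × ℂ) ∈ φ.target := h0 ▸ φ.map_source hp
  have hN0 : ∀ u : ℂ, pullNumerator β φ blowupFst (0, u) = 0 := by
    intro u
    have hP0 : blowupFst (0, u) = 0 := by simp [blowupFst]
    -- The exact description of the target is needed: the chart contains the points `(0, u)` for all
    -- `u`, not just those near one point.
    have hu : ((0 : ℂ), u) ∈ ψ.target := by
      rw [htarget]
      change blowupFst (0, u) ∈ φ.target
      rwa [hP0]
    have hd := hβ' _ ψ hψ (ψ.map_target hu)
    rw [ψ.right_inv hu] at hd
    -- Off `x = 0`, the numerator is `x` times the lift. Both sides are continuous, so this persists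
    -- at `x = 0`, where the right-hand side is zero.
    have hd1 : DifferentiableAt ℂ (fun q : ℂ × ℂ => q.1 • chartForm β' ψ q) (0, u) :=
      differentiableAt_fst.fun_smul hd
    have hd2 := differentiableAt_pullNumerator hβ hφ (analyticAt_blowupFst (0, u))
      (by rwa [hP0] : blowupFst (0, u) ∈ φ.target)
    have := tendsto_nhds_unique_of_frequently_eq hd2.continuousAt.tendsto
      hd1.continuousAt.tendsto (((frequently_fst_ne (0, u) 0).and_eventually
        (ψ.open_target.eventually_mem hu)).mono fun q hq => ?_)
    · rw [this, zero_smul]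
    · have hne : π (ψ.symm q) ≠ p := fun hqp =>
        hq.1 (congrArg Prod.fst ((map_eq_center_iff hp h0 hsub hP hq.2).1 hqp))
      rw [chartForm_eq_pullNumerator hφ hψ hπ.holomorphic hsub hP hq.2 (h _ hne)]
      change _ = q.1 • ((planeDet (fderiv ℂ blowupFst q))⁻¹ • pullNumerator β φ blowupFst q)
      rw [planeDet_fderiv_blowupFst, smul_inv_smul₀ hq.1]
  have hB : chartForm β φ 0 = 0 := by
    have hflip : (chartForm β φ 0).flip = chartForm β φ 0 := by
      rw [chartForm, ← PlaneForm.pull_flip, ← h0, φ.left_inv hp, hs]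
    refine PlaneForm.eq_zero_of_symm (fun v w => ?_) fun u => ?_
    · conv_lhs => rw [← hflip]
      rfl
    -- The derivative of the blowup map at `(0, u)` sends `(1, 0)` to `(1, u)`.
    · have := congrArg (fun B : PlaneForm => B (1, 0) (1, 0)) (hN0 u)
      simpa [pullNumerator, fderiv_blowupFst_apply, blowupFst, Prod.mk_zero_zero] using this
  rw [← pull_chartForm β hφ hp, h0, hB, PlaneForm.pull_zero]

/-- A holomorphic section on the blowup descends. -/
theorem exists_descent [IsManifold 𝓘(ℂ, ℂ × ℂ) ω X] [IsManifold 𝓘(ℂ, ℂ × ℂ) ω X'] [T1Space X]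
    (hπ : IsBlowup π p) {β' : X' → PlaneForm} (hβ' : ∀ x, HolAt β' x)
    (hs : ∀ x, (β' x).flip = β' x) :
    ∃ β : X → PlaneForm, (∀ x, HolAt β x) ∧ (∀ x, (β x).flip = β x) ∧
      ∀ x, π x ≠ p → β' x = PlaneForm.pull (derivAt π x) (β (π x)) := by
  obtain ⟨σ, hσ, hπσ, hσπ⟩ := hπ.exists_inverse
  have hσa : ∀ x, x ≠ p → ContMDiffAt 𝓘(ℂ, ℂ × ℂ) 𝓘(ℂ, ℂ × ℂ) ω σ x := fun x hx =>
    hσ.contMDiffAt (isOpen_compl_singleton.mem_nhds hx)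
  have hne : ∀ {x}, x ≠ p → ∀ᶠ y in 𝓝 x, y ≠ p := isOpen_ne.eventually_mem
  have hβ₀ : ∀ x, x ≠ p → HolAt (fun x => PlaneForm.pull (derivAt σ x) (β' (σ x))) x :=
    fun x hx => (hβ' (σ x)).pull ((hne hx).mono hσa)
      (planeDet_derivAt_ne_zero (g := π) (hπ.holomorphic.mdifferentiableAt (by simp))
        ((hσa x hx).mdifferentiableAt (by simp)) ((hne hx).mono hπσ))
      (Eventually.of_forall fun _ => rfl)
  refine (exists_holAt_extension (S := {p}) isClosed_singleton
    (fun x _ => frequently_nhds_ne x p) hβ₀ ?_).imp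
    fun β ⟨hoff, hhol⟩ => ⟨hhol, fun x => ?_, fun x hx => ?_⟩
  · intro x hx
    have he := IsManifold.chart_mem_maximalAtlas (I := 𝓘(ℂ, ℂ × ℂ)) (n := ω) x
    have hxe := mem_chart_source (ℂ × ℂ) x
    refine ⟨chartAt _ x, he, hxe, ?_⟩
    have hsymm : ∀ᶠ z in 𝓝 (chartAt (ℂ × ℂ) x x), z ∈ (chartAt (ℂ × ℂ) x).target ∧
        (z ≠ chartAt (ℂ × ℂ) x x ↔ (chartAt (ℂ × ℂ) x).symm z ∉ ({p} : Set X)) := by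
      filter_upwards [(chartAt (ℂ × ℂ) x).open_target.mem_nhds (mem_chart_target (ℂ × ℂ) x)]
        with z hz
      refine ⟨hz, not_congr ?_⟩
      rw [Set.mem_singleton_iff, ← Set.mem_singleton_iff.1 hx]
      constructor
      · rintro rfl
        exact (chartAt (ℂ × ℂ) x).left_inv hxe
      · intro h
        rw [← (chartAt (ℂ × ℂ) x).right_inv hz, h]
    -- Hartogs: in the chart, the section is holomorphic except at the single point corresponding to
    -- `p`.
    obtain ⟨G, hG⟩ := exists_differentiableAt_eq_of_ne
      (f := chartForm (fun x => PlaneForm.pull (derivAt σ x) (β' (σ x))) (chartAt (ℂ × ℂ) x))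
      (c := chartAt (ℂ × ℂ) x x) (hsymm.mono fun z hz hzne => by
        have := hβ₀ _ (hz.2.1 hzne) _ he ((chartAt (ℂ × ℂ) x).map_target hz.1)
        rwa [(chartAt (ℂ × ℂ) x).right_inv hz.1] at this)
    refine ⟨G, ?_⟩
    filter_upwards [hG, hsymm] with z hz hzs
    exact ⟨hz.1, fun h => hz.2 (hzs.2.2 h)⟩
  -- Symmetry is inherited from `β'` off `p` and holds at `p` by continuity.
  · refine (hhol x).flip.eq_of_frequently (hhol x) ((frequently_nhds_ne x p).mono fun y hy => ?_)
    rw [hoff y hy, ← PlaneForm.pull_flip, hs]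
  · rw [hoff _ hx, ← PlaneForm.pull_comp, derivAt_comp_eq_id
      ((hσa _ hx).mdifferentiableAt (by simp)) (hπ.holomorphic.mdifferentiableAt (by simp))
      ((hπ.holomorphic.continuous.continuousAt.eventually_ne hx).mono hσπ), PlaneForm.pull_id,
      hσπ x hx]

/-- Sections on the blowup that correspond to sections on the surface determine them. -/
theorem eq_of_pull_eq [IsManifold 𝓘(ℂ, ℂ × ℂ) ω X] [T1Space X]
    (hπ : IsBlowup π p) {β γ : X → PlaneForm} (hβ : ∀ x, HolAt β x) (hγ : ∀ x, HolAt γ x)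
    (h : ∀ x, π x ≠ p →
      PlaneForm.pull (derivAt π x) (β (π x)) = PlaneForm.pull (derivAt π x) (γ (π x))) :
    β = γ := by
  obtain ⟨σ, hσ, hπσ, -⟩ := hπ.exists_inverse
  have hoff : ∀ x, x ≠ p → β x = γ x := by
    intro x hx
    have hid := derivAt_comp_eq_id (hπ.holomorphic.mdifferentiableAt (by simp))
      ((hσ.contMDiffAt (isOpen_compl_singleton.mem_nhds hx)).mdifferentiableAt (by simp))
      ((isOpen_ne.eventually_mem hx).mono hπσ)
    have := congrArg (PlaneForm.pull (derivAt σ x)) (h (σ x) (by rwa [hπσ x hx]))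
    rwa [← PlaneForm.pull_comp, ← PlaneForm.pull_comp, hid, PlaneForm.pull_id, PlaneForm.pull_id,
      hπσ x hx] at this
  exact funext fun x => (hβ x).eq_of_frequently (hγ x) ((frequently_nhds_ne x p).mono hoff)

end IsBlowup

theorem TwistedTensor.det_eq_disc (τ : TwistedTensor X) (x : X) :
    τ.det x = (τ.form x).disc :=
  TwistedForm.det_endo _

/-- By `disc_pull` the determinant can be computed from the holomorphic coefficients in any chart.
-/
theorem TwistedTensor.mdifferentiable_det [IsManifold 𝓘(ℂ, ℂ × ℂ) ω X] {τ : TwistedTensor X}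
    (hτ : ∀ x, HolAt τ.form x) : MDifferentiable 𝓘(ℂ, ℂ × ℂ) 𝓘(ℂ, ℂ) τ.det := by
  intro x
  have he := IsManifold.chart_mem_maximalAtlas (I := 𝓘(ℂ, ℂ × ℂ)) (n := ω) x
  have hx := mem_chart_source (ℂ × ℂ) x
  have hd := hτ x _ he hx
  have happ : ∀ v w, DifferentiableAt ℂ (fun z => chartForm τ.form (chartAt (ℂ × ℂ) x) z v w)
      (chartAt (ℂ × ℂ) x x) := fun v w =>
    (hd.clm_apply (differentiableAt_const v)).clm_apply (differentiableAt_const w)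
  have hdisc : DifferentiableAt ℂ (fun z => (chartForm τ.form (chartAt (ℂ × ℂ) x) z).disc)
      (chartAt (ℂ × ℂ) x x) :=
    ((happ _ _).mul (happ _ _)).sub ((happ _ _).mul (happ _ _))
  refine (hdisc.mdifferentiableAt.comp x
    (mdifferentiableAt_of_mem_atlas he hx)).congr_of_eventuallyEq ?_
  filter_upwards [(chartAt (ℂ × ℂ) x).open_source.mem_nhds hx] with y hy
  have hz := (chartAt (ℂ × ℂ) x).map_source hy
  rw [Function.comp_apply, chartForm, PlaneForm.disc_pull _ _ (planeDet_symm_ne_zero he hz),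
    (chartAt (ℂ × ℂ) x).left_inv hy, τ.det_eq_disc]

end Blowup

end

/-! ### The main theorem -/

theorem mainTheorem8
    {X : Type*} [TopologicalSpace X] [ChartedSpace (ℂ × ℂ) X]
    [IsManifold 𝓘(ℂ, ℂ × ℂ) ω X] [T2Space X] [ConnectedSpace X]
    {X' : Type*} [TopologicalSpace X'] [ChartedSpace (ℂ × ℂ) X']
    [IsManifold 𝓘(ℂ, ℂ × ℂ) ω X'] [T2Space X'] [ConnectedSpace X']
    (π : X' → X) (p : X) (hπ : IsBlowup π p) :
    (∀ τ' : TwistedTensor X', IsSpecialTensor τ' →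
      ∃! τ : TwistedTensor X, IsSpecialTensor τ ∧ CorrespondOff π p τ' τ) ∧
    (∀ τ : TwistedTensor X, IsSpecialTensor τ →
      ((∃ τ' : TwistedTensor X', IsSpecialTensor τ' ∧ CorrespondOff π p τ' τ) ↔ τ p = 0)) ∧
    (CompactSpace X → ∀ τ : TwistedTensor X, IsSpecialTensor τ → τ p = 0 →
      ∀ x : X, τ.det x = 0) := by
  have hcorr := fun (τ' : TwistedTensor X') (τ : TwistedTensor X) =>
    correspondOff_iff (τ' := τ') (τ := τ) fun _ => hπ.planeDet_ne_zero
  have hfreq : ∀ x : X', ∃ᶠ y in nhds x, π y ≠ p := by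
    intro x
    by_cases hx : π x = p
    · exact hπ.frequently_ne hx
    · exact (hπ.holomorphic.continuous.continuousAt.eventually_ne hx).frequently
  refine ⟨fun τ' hτ' => ?_, fun τ hτ => ?_, fun hX τ hτ h0 x => ?_⟩
  · obtain ⟨hs', hh', hn'⟩ := isSpecialTensor_iff.1 hτ'
    obtain ⟨β, hh, hs, hc⟩ := hπ.exists_descent hh' hs'
    obtain ⟨τ, rfl⟩ := TwistedTensor.exists_form_eq β
    refine ⟨τ, ⟨isSpecialTensor_iff.2 ⟨hs, hh, fun h0 => hn' (funext fun x => ?_)⟩,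
      (hcorr τ' τ).2 hc⟩, fun τ₁ hτ₁ => ?_⟩
    -- If the descended tensor were zero, `τ'` would vanish off the exceptional curve, hence
    -- everywhere by density.
    · refine (hh' x).eq_of_frequently holAt_zero ((hfreq x).mono fun y hy => ?_)
      rw [hc y hy, h0, PlaneForm.pull_zero]
    · refine TwistedTensor.form_injective (hπ.eq_of_pull_eq (isSpecialTensor_iff.1 hτ₁.1).2.1 hh
        fun y hy => ?_)
      rw [← hc y hy, ← (hcorr τ' τ₁).1 hτ₁.2 y hy]
  · obtain ⟨hs, hh, hn⟩ := isSpecialTensor_iff.1 hτ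
    constructor
    · rintro ⟨τ', hτ', hc⟩
      exact TwistedTensor.eq_of_form_eq (τ' := 0) (hπ.eq_zero_of_lift hh (hs p)
        (isSpecialTensor_iff.1 hτ').2.1 ((hcorr τ' τ).1 hc))
    · intro h0
      obtain ⟨β', hh', hc⟩ := hπ.exists_lift hh (congrArg TwistedForm.toPlaneForm h0)
      obtain ⟨τ', rfl⟩ := TwistedTensor.exists_form_eq β'
      refine ⟨τ', isSpecialTensor_iff.2 ⟨fun x => ?_, hh', fun h0' => hn ?_⟩, (hcorr τ' τ).2 hc⟩
      · refine (hh' x).flip.eq_of_frequently (hh' x) ((hfreq x).mono fun y hy => ?_)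
        rw [hc y hy, ← PlaneForm.pull_flip, hs]
      · refine hπ.eq_of_pull_eq hh (fun _ => holAt_zero) fun y hy => ?_
        rw [← hc y hy, h0', PlaneForm.pull_zero]
  · have hd := TwistedTensor.mdifferentiable_det (isSpecialTensor_iff.1 hτ).2.1
    -- A holomorphic function on a compact connected manifold is constant, so it may be evaluated at
    -- `p`.
    rw [hd.apply_eq_of_compactSpace x p, τ.det_eq_disc,
      show τ.form p = 0 from congrArg TwistedForm.toPlaneForm h0]
    simp [PlaneForm.disc]
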